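/- **Setting.** Let $\mathbf P$ be a probability distribution on $\mathbf R^d$ with finite second moment and $\mathbf P(S)=1$, and let $\hat u^1,\hat u^2,\dots$ be i.i.d. with law $\mathbf P$; "almost surely" refers to $\mathbf P^\infty$. For $n_0\ge 1$ and $t\ge 0$ let $n_t=n_0+t$, $\mathcal D_t=(\hat u^i)_{i\le n_t}$ and $\hat{\mathbf P}_t=\frac1{n_t}\sum_{i\le n_t}\delta_{\hat u^i}$. $\|\cdot\|$ is the Euclidean norm, $W_p$ the Wasserstein-$p$ distance for it, and $$W^K_{\star,p}(\mathbf Q)=\Big(\inf_{A\subset\mathbf R^d,\,|A|\le K}\mathbf E_{\mathbf Q}\big[\min_{a\in A}\|u-a\|^p\big]\Big)^{1/p}.$$ *Objective.* $f(u,x)=\max_{j\le J}f_j(u,x)$ with $J\ge1$, $x\in\mathcal X\subset\mathbf R^m$, $\mathcal X$ compact, each $f_j(\cdot,x)$ proper, concave and upper semicontinuous, and $\mathrm{dom} f=\{u: f(u,x)>-\infty\}\supseteq S$ independent of $x\in\mathcal X$. Either $\mathrm{dom} f=\mathbf R^d$; or $f$ is elementwise increasing in $u$ and $\mathrm{dom}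 f$ is only restricted from below (closed under increasing coordinates); or $f$ is elementwise decreasing in $u$ and $\mathrm{dom} f$ is only restricted from above. Constants $M_j,L_j,L\ge0$ are given, and at least one of the following holds for all $x\in\mathcal X$ on $\mathrm{dom} f$: (i) each $f_j(\cdot,x)$ is $M_j$-Lipschitz; (ii) each $f_j(\cdot,x)$ is differentiable with $L_j$-Lipschitz gradient; (iii) $f(\cdot,x)$ is differentiable with $L$-Lipschitz gradient. *Clustering.* At each $t$ the clustering rule computes from $\mathcal D_t$ (measurably) at most $K$ nonempty cluster supports $S^k_t\subseteq S$, and it puts every data point into one cluster $C^k_t$ whose support contains it. Almost surely, for all $t$: the supports have pairwise disjoint interiors, cover $S$, have positive $\mathbf P$-measure and $\mathbf P$-null boundaries, and there is a finite (possibly data-dependent) $\tau$ with $S^k_t=S^k_\tau$ for all $t\ge\tau$ and all $k$. With $n^k_t=|C^k_t|$ and cluster means $\bar u^k_t$, let $\hat{\mathbf P}^K_t=\sum_k\frac{n^k_t}{n_t}\delta_{\bar u^k_t}$, $$D^K_{t,p}=\Big(\tfrac1{n_t}\sum_k\sum_{\hat u\in C^k_t}\|\hat u-\bar u^k_t\|^p\Big)^{1/p},\qquad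 W^K_{t,p}=W_p(\hat{\mathbf P}_t,\hat{\mathbf P}^K_t).$$ With $\bar u^k_\star=\mathbf E_{\mathbf P}[u\mid u\in S^k_\tau]$ let $\mathbf P^K_\star=\sum_k\mathbf P(S^k_\tau)\delta_{\bar u^k_\star}$, $$W^K_{\star,p}=W_p(\mathbf P,\mathbf P^K_\star),\qquad D^K_{\star,p}=\Big(\mathbf E_{\mathbf P}\Big[\sum_k\mathbf 1\{u\in S^k_\tau\}\|u-\bar u^k_\star\|^p\Big]\Big)^{1/p}.$$ *Upper bound.* $\bar\psi^K_\star=\min\{\max_j\frac{L_j}2(D^K_{\star,2})^2,\ \max_jM_j\,W^K_{\star,1}\}$. Here and below, a term whose condition ((ii) for $L_j$, (i) for $M_j$, (iii) for $L$) fails is replaced by $\infty$. *Online problem.* For radii $\varepsilon_t\ge0$, an order $r\in[1,\infty]$ with $1/r+1/q=1$, and an arbitrary norm with dual norm $\|\cdot\|_*$, let $(x_t,\lambda_t,s_t,z_t,y_t)$ be an optimal solution of: minimize $\sum_k\frac{n^k_t}{n_t}s^k$ over $x\in\mathcal X$, $\lambda\ge0$, $s^k\in\mathbf R$, $z^{jk},y^{jk}\in\mathbf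 R^d$ subject to, for all $k$ and $j$, $$[-f_j]^*(z^{jk}-y^{jk},x)+\sigma_S(y^{jk})-(z^{jk})^T\bar u^k_t+\phi(q)\lambda\|z^{jk}/\lambda\|_*^q+\lambda\varepsilon_t^r\le s^k,$$ where $[-f_j]^*(z,x)=\sup_{u\in\mathrm{dom} f}\{z^Tu+f_j(u,x)\}$, $\sigma_S(y)=\sup_{u\in S}y^Tu$ and $\phi(q)=(q-1)^{q-1}/q^q$. (For $\lambda=0$ the transport term is the limit as $\lambda\downarrow0$. For $r=1$ the last two summands are $\lambda\varepsilon_t$ under the constraint $\|z^{jk}\|_*\le\lambda$; for $r=\infty$ they are $\varepsilon_t\|z^{jk}\|_*$. For an empty cluster, whose weight is $0$, take $\bar u^k_t=0$.) Let $$\Phi^K_t=\mathbf 1\{J\ge2\}\frac1{n_t}\sum_k\sum_{\hat u\in C^k_t}\max_j(-z^{jk}_t)^T(\hat u-\bar u^k_t),$$ $$\underline\psi^K_\star=\min\Big\{\limsup_t\Phi^K_t,\ \max_jM_j\,W^K_{\star,1},\ \sup_{\hat x}\Big(\|\nabla f(\cdot,\hat x)\|_{L_2(\mathbf P^K_\star)}W^K_{\star,2}+\tfrac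 L2(W^K_{\star,2})^2\Big)\Big\},$$ with the supremum over the accumulation points $\hat x$ of $(x_t)$. An accumulation point $z_\star=(z^{jk}_\star)_{j,k}$ of $(z_t)$ *achieves the limit superior* if, along some subsequence, $z_t\to z_\star$ and $\Phi^K_t\to\limsup_t\Phi^K_t$; for such $z_\star$ let $$\Phi^K_\star=\mathbf 1\{J\ge2\}\,\mathbf E_{\mathbf P}\Big[\sum_k\mathbf 1\{u\in S^k_\tau\}\max_j(-z^{jk}_\star)^T(u-\bar u^k_\star)\Big].$$ **Theorem (Optimal clustering bounds).** 1. If almost surely $D^K_{t,2}=W^K_{t,2}=W^K_{\star,2}(\hat{\mathbf P}_t)$ for all $t$, then almost surely $$\bar\psi^K_\star=\min\Big\{\max_j\tfrac{L_j}2\big(W^K_{\star,2}(\mathbf P)\big)^2,\ \max_jM_j\,W^K_{\star,1}\Big\}.$$ 2. Suppose $S=\mathbf R^d$, $f$ is maximum-of-affine in both arguments, i.e. $f_j(u,x)=(A_jx+a_j)^Tu+b_j^Tx+c_j$ for constant $A_j,a_j,b_j,c_j$, and almost surely $D^K_{t,1}=W^K_{t,1}$ for all $t$. Then almost surely an accumulation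 point of $(z_t)$ that achieves the limit superior exists, and for each such point $$\underline\psi^K_\star\le\Phi^K_\star\le\max_jM_j\,W^K_{\star,1}.$$ -/

import Mathlib

open MeasureTheory Filter Topology
open scoped ENNReal NNReal RealInnerProductSpace

noncomputable section

namespace ClusterDRO

/-- `ℝᵐ` with the Euclidean norm. -/
abbrev Vec (m : ℕ) := EuclideanSpace ℝ (Fin m)

/-! ### Wasserstein distance and quantization error (Euclidean ground norm) -/

/-- The type-`p` Wasserstein distance, as an infimum over all couplings. -/
def wasserstein {d : ℕ} (p : ℝ) (μ ν : Measure (Vec d)) : ℝ≥0∞ :=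
  (⨅ (π : Measure (Vec d × Vec d)) (_ : π.map Prod.fst = μ ∧ π.map Prod.snd = ν),
    ∫⁻ w, ‖w.1 - w.2‖ₑ ^ p ∂π) ^ (1 / p)

/-- The minimum quantization error of order `p` with at most `K` centres. An empty set of centres
has infinite error, because an infimum over the empty set is `∞`. -/
def quantError {d : ℕ} (K : ℕ) (p : ℝ) (μ : Measure (Vec d)) : ℝ≥0∞ :=
  (⨅ (A : Finset (Vec d)) (_ : A.card ≤ K), ∫⁻ u, ⨅ a ∈ A, ‖u - a‖ₑ ^ p ∂μ) ^ (1 / p)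

/-! ### The objective function -/

section Objective

variable {d m J : ℕ}

/-- The objective `f(u, x) = max_j f_j(u, x)`. -/
def maxObj (f : Fin J → Vec d → Vec m → EReal) (u : Vec d) (x : Vec m) : EReal := ⨆ j, f j u x

/-- The setting for the objective: `X` is compact, each `f_j(·, x)` is proper, concave (convex
hypograph) and upper semicontinuous for `x ∈ X`, the domain of `f(·, x)` is the same set `dom` for
all `x ∈ X`, and it contains the support `S`. -/
structure ObjectiveSetting (X : Set (Vec m)) (f : Fin J → Vec d → Vec m → EReal)
    (dom S : Set (Vec d)) : Prop where
  compact : IsCompact X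
  ne_top : ∀ j, ∀ x ∈ X, ∀ u, f j u x ≠ ⊤
  proper : ∀ j, ∀ x ∈ X, ∃ u, f j u x ≠ ⊥
  concave : ∀ j, ∀ x ∈ X, Convex ℝ {w : Vec d × ℝ | (w.2 : EReal) ≤ f j w.1 x}
  usc : ∀ j, ∀ x ∈ X, UpperSemicontinuous fun u => f j u x
  dom_eq : ∀ x ∈ X, {u | maxObj f u x ≠ ⊥} = dom
  supp_subset : S ⊆ dom

/-- Each `f_j(·, x)` is finite and `M_j`-Lipschitz on the domain, for all `x ∈ X`. -/
def LipschitzPieces (X : Set (Vec m)) (f : Fin J → Vec d → Vec m → EReal) (dom : Set (Vec d))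
    (M : Fin J → ℝ≥0) : Prop :=
  ∀ j, ∀ x ∈ X, (∀ u ∈ dom, f j u x ≠ ⊥) ∧
    ∀ u ∈ dom, ∀ v ∈ dom, |(f j v x).toReal - (f j u x).toReal| ≤ M j * ‖u - v‖

/-- A finite differentiable function on `dom` with an `L`-Lipschitz gradient there. -/
def SmoothOn (g : Vec d → EReal) (dom : Set (Vec d)) (L : ℝ≥0) : Prop :=
  (∀ u ∈ dom, g u ≠ ⊥) ∧ DifferentiableOn ℝ (fun u => (g u).toReal) dom ∧
    ∀ u ∈ dom, ∀ v ∈ dom,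
      ‖gradientWithin (fun w => (g w).toReal) dom v
        - gradientWithin (fun w => (g w).toReal) dom u‖ ≤ L * ‖u - v‖

/-- Each `f_j(·, x)` is `L_j`-smooth on the domain, for all `x ∈ X`. -/
def SmoothPieces (X : Set (Vec m)) (f : Fin J → Vec d → Vec m → EReal) (dom : Set (Vec d))
    (L : Fin J → ℝ≥0) : Prop :=
  ∀ j, ∀ x ∈ X, SmoothOn (fun u => f j u x) dom (L j)

/-- `f(·, x)` itself is `L`-smooth on the domain, for all `x ∈ X`. -/
def SmoothMax (X : Set (Vec m)) (f : Fin J → Vec d → Vec m → EReal) (dom : Set (Vec d))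
    (L : ℝ≥0) : Prop :=
  ∀ x ∈ X, SmoothOn (fun u => maxObj f u x) dom L

/-- The domain is all of `ℝᵈ`; or `f` is elementwise increasing in `u` and the domain is only
restricted from below (it is closed under increasing coordinates); or `f` is elementwise decreasing
in `u` and the domain is only restricted from above. -/
def DomainCondition (X : Set (Vec m)) (f : Fin J → Vec d → Vec m → EReal)
    (dom : Set (Vec d)) : Prop :=
  dom = Set.univ ∨
  ((∀ u ∈ dom, ∀ v, (∀ i, u i ≤ v i) → v ∈ dom) ∧
    ∀ x ∈ X, ∀ u ∈ dom, ∀ v ∈ dom, (∀ i, u i ≤ v i) → maxObj f u x ≤ maxObj f v x) ∨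
  ((∀ u ∈ dom, ∀ v, (∀ i, v i ≤ u i) → v ∈ dom) ∧
    ∀ x ∈ X, ∀ u ∈ dom, ∀ v ∈ dom, (∀ i, u i ≤ v i) → maxObj f v x ≤ maxObj f u x)

/-- `f` is maximum-of-affine in both arguments: each `f_j` is affine in `u` and affine in `x`
(bilinear terms in `u` and `x` are allowed). -/
def MaxOfAffine (X : Set (Vec m)) (f : Fin J → Vec d → Vec m → EReal) : Prop :=
  ∀ j, ∃ (A : Vec m →ᵃ[ℝ] Vec d) (b : Vec m →ᵃ[ℝ] ℝ),
    ∀ x ∈ X, ∀ u, f j u x = ((⟪A x, u⟫ + b x : ℝ) : EReal)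

end Objective

/-! ### Data, clustering rules, and the clustered empirical distribution -/

section Clustering

variable {d K : ℕ}

/-- The first `n` data points of a stream. -/
def dataset (n : ℕ) (ω : ℕ → Vec d) : Fin n → Vec d := fun i => ω i

/-- The law `P^∞` of an i.i.d. data stream. -/
abbrev streamLaw (P : Measure (Vec d)) [IsProbabilityMeasure P] : Measure (ℕ → Vec d) :=
  Measure.infinitePi fun _ : ℕ => P

/-- An online clustering rule with at most `K` clusters: from the data seen up to time `t`
(`n₀ + t` points) it computes the cluster supports and the cluster of each data point.
A cluster slot with an empty support is not in use, so that `K_t` is the number of slots with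
nonempty support. -/
structure ClusteringRule (d n₀ K : ℕ) where
  supp : (t : ℕ) → (Fin (n₀ + t) → Vec d) → Fin K → Set (Vec d)
  label : (t : ℕ) → (Fin (n₀ + t) → Vec d) → Fin (n₀ + t) → Fin K

/-- The supports at time `t` along the stream `ω`. -/
def ClusteringRule.suppAt {n₀ : ℕ} (C : ClusteringRule d n₀ K) (ω : ℕ → Vec d) (t : ℕ) :
    Fin K → Set (Vec d) := C.supp t (dataset (n₀ + t) ω)

/-- The cluster labels at time `t` along the stream `ω`. -/
def ClusteringRule.labelAt {n₀ : ℕ} (C : ClusteringRule d n₀ K) (ω : ℕ → Vec d) (t : ℕ) :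
    Fin (n₀ + t) → Fin K := C.label t (dataset (n₀ + t) ω)

/-- The requirements on the cluster supports. Each data point is put into a cluster whose support
contains it. -/
structure SupportRequirements {n₀ : ℕ} (P : Measure (Vec d)) [IsProbabilityMeasure P]
    (S : Set (Vec d)) (C : ClusteringRule d n₀ K) : Prop where
  measurable : ∀ t k, MeasurableSet {w : (Fin (n₀ + t) → Vec d) × Vec d | w.2 ∈ C.supp t w.1 k}
  label_mem : ∀ᵐ ω ∂(streamLaw P), ∀ t, ∀ i : Fin (n₀ + t), ω i ∈ C.suppAt ω t (C.labelAt ω t i)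
  disjoint_interior : ∀ᵐ ω ∂(streamLaw P), ∀ t, ∀ k k', k ≠ k' →
    interior (C.suppAt ω t k) ∩ interior (C.suppAt ω t k') = ∅
  cover : ∀ᵐ ω ∂(streamLaw P), ∀ t, ⋃ k, C.suppAt ω t k = S
  pos : ∀ᵐ ω ∂(streamLaw P), ∀ t k, (C.suppAt ω t k).Nonempty → 0 < P (C.suppAt ω t k)
  boundary_null : ∀ᵐ ω ∂(streamLaw P), ∀ t k, P (frontier (C.suppAt ω t k)) = 0
  stable : ∀ᵐ ω ∂(streamLaw P), ∃ τ, ∀ t ≥ τ, C.suppAt ω t = C.suppAt ω τ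

/-- The empirical distribution of `n` points. -/
def empirical {n : ℕ} (D : Fin n → Vec d) : Measure (Vec d) :=
  (n : ℝ≥0∞)⁻¹ • ∑ i, Measure.dirac (D i)

/-- The number of points in cluster `k`. -/
def clusterCard {n : ℕ} (l : Fin n → Fin K) (k : Fin K) : ℕ := (Finset.univ.filter (l · = k)).card

/-- The mean of cluster `k`. -/
def clusterMean {n : ℕ} (D : Fin n → Vec d) (l : Fin n → Fin K) (k : Fin K) : Vec d :=
  (clusterCard l k : ℝ)⁻¹ • ∑ i ∈ Finset.univ.filter (l · = k), D i

/-- The clustered empirical distribution. -/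
def clustered {n : ℕ} (D : Fin n → Vec d) (l : Fin n → Fin K) : Measure (Vec d) :=
  ∑ k, ((clusterCard l k : ℝ≥0∞) / n) • Measure.dirac (clusterMean D l k)

/-- `D_{t,p}^K`. -/
def clusterValue {n : ℕ} (p : ℝ) (D : Fin n → Vec d) (l : Fin n → Fin K) : ℝ≥0∞ :=
  ((n : ℝ≥0∞)⁻¹ * ∑ k, ∑ i ∈ Finset.univ.filter (l · = k), ‖D i - clusterMean D l k‖ₑ ^ p)
    ^ (1 / p)

/-- `W_{t,p}^K`. -/
def clusterWass {n : ℕ} (p : ℝ) (D : Fin n → Vec d) (l : Fin n → Fin K) : ℝ≥0∞ :=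
  wasserstein p (empirical D) (clustered D l)

/-- `Φ_t^K`. -/
def phi {J n : ℕ} (D : Fin n → Vec d) (l : Fin n → Fin K) (z : Fin J → Fin K → Vec d) : ℝ :=
  if 2 ≤ J then
    (n : ℝ)⁻¹ * ∑ k, ∑ i ∈ Finset.univ.filter (l · = k), ⨆ j, ⟪-(z j k), D i - clusterMean D l k⟫
  else 0

/-! Asymptotic counterparts, for final cluster supports `T`. -/

/-- The mean of `P` conditioned on the support `T k`. -/
def limitMean (P : Measure (Vec d)) (T : Fin K → Set (Vec d)) (k : Fin K) : Vec d :=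
  ⨍ u in T k, u ∂P

/-- The limit `P_⋆^K` of the clustered empirical distributions. -/
def limitDist (P : Measure (Vec d)) (T : Fin K → Set (Vec d)) : Measure (Vec d) :=
  ∑ k, P (T k) • Measure.dirac (limitMean P T k)

/-- `W_{⋆,p}^K = W_p(P, P_⋆^K)`. -/
def limitWass (p : ℝ) (P : Measure (Vec d)) (T : Fin K → Set (Vec d)) : ℝ≥0∞ :=
  wasserstein p P (limitDist P T)

/-- `D_{⋆,p}^K`. -/
def limitValue (p : ℝ) (P : Measure (Vec d)) (T : Fin K → Set (Vec d)) : ℝ≥0∞ :=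
  (∫⁻ u, ∑ k, (T k).indicator (fun u => ‖u - limitMean P T k‖ₑ ^ p) u ∂P) ^ (1 / p)

/-- `Φ_⋆^K` for limiting dual variables `z`. -/
def limitPhi {J : ℕ} (P : Measure (Vec d)) (T : Fin K → Set (Vec d))
    (z : Fin J → Fin K → Vec d) : ℝ :=
  if 2 ≤ J then
    ∫ u, ∑ k, (T k).indicator (fun u => ⨆ j, ⟪-(z j k), u - limitMean P T k⟫) u ∂P
  else 0

end Clustering

/-! ### The compressed distributionally robust program -/

section Program

variable {d m J K : ℕ}

/-- The conjugate of `-f_j(·, x)`. -/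
def negConj (f : Fin J → Vec d → Vec m → EReal) (dom : Set (Vec d)) (j : Fin J) (x : Vec m)
    (z : Vec d) : EReal := ⨆ u ∈ dom, ((⟪z, u⟫ : ℝ) : EReal) + f j u x

/-- The support function of `S`. -/
def supportFun (S : Set (Vec d)) (y : Vec d) : EReal := ⨆ u ∈ S, ((⟪y, u⟫ : ℝ) : EReal)

/-- The dual of a norm `N` on `ℝᵈ`. -/
def dualNorm (N : Seminorm ℝ (Vec d)) (z : Vec d) : ℝ := sSup {a | ∃ u, N u ≤ 1 ∧ a = ⟪z, u⟫}

/-- `φ(q) = (q-1)^(q-1) / q^q`. -/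
def phiExp (q : ℝ) : ℝ := (q - 1) ^ (q - 1) / q ^ q

/-- The transport term `φ(q) lam ‖z/lam‖_*^q + lam ε^r` with `1/r + 1/q = 1`, where `ν = ‖z‖_*`.
Its usual conventions: for `lam = 0` it is the limit as `lam ↓ 0`; for `r = 1` (`q = ∞`) it is
`lam ε` under the constraint `‖z‖_* ≤ lam`; for `r = ∞` it is `ε ‖z‖_*`, without `lam`. -/
def transportTerm (r : ℝ≥0∞) (ε lam ν : ℝ) : EReal :=
  if r = ⊤ then ((ε * ν : ℝ) : EReal)
  else if r = 1 then (if ν ≤ lam then ((lam * ε : ℝ) : EReal) else ⊤)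
  else if lam = 0 then (if ν = 0 then 0 else ⊤)
  else
    let q : ℝ := r.toReal / (r.toReal - 1)
    ((phiExp q * lam * (ν / lam) ^ q + lam * ε ^ r.toReal : ℝ) : EReal)

/-- The variables of the program. -/
structure Vars (d m J K : ℕ) where
  x : Vec m
  lam : ℝ
  s : Fin K → ℝ
  z : Fin J → Fin K → Vec d
  y : Fin J → Fin K → Vec d

/-- Feasibility; `T` are the current cluster supports, and only slots in use give constraints. -/
def Feasible (X : Set (Vec m)) (f : Fin J → Vec d → Vec m → EReal) (dom S : Set (Vec d))
    (N : Seminorm ℝ (Vec d)) (r : ℝ≥0∞) (ε : ℝ) (T : Fin K → Set (Vec d)) {n : ℕ}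
    (D : Fin n → Vec d) (l : Fin n → Fin K) (v : Vars d m J K) : Prop :=
  v.x ∈ X ∧ 0 ≤ v.lam ∧ ∀ k, (T k).Nonempty → ∀ j,
    negConj f dom j v.x (v.z j k - v.y j k) + supportFun S (v.y j k)
      + ((-⟪v.z j k, clusterMean D l k⟫ : ℝ) : EReal)
      + transportTerm r ε v.lam (dualNorm N (v.z j k)) ≤ ((v.s k : ℝ) : EReal)

/-- The objective value `∑ₖ θₖ sₖ`. -/
def Vars.objective (v : Vars d m J K) {n : ℕ} (l : Fin n → Fin K) : ℝ :=
  ∑ k, ((clusterCard l k : ℝ) / n) * v.s k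

/-- Optimal solutions of the compressed program. -/
def IsOptimal (X : Set (Vec m)) (f : Fin J → Vec d → Vec m → EReal) (dom S : Set (Vec d))
    (N : Seminorm ℝ (Vec d)) (r : ℝ≥0∞) (ε : ℝ) (T : Fin K → Set (Vec d)) {n : ℕ}
    (D : Fin n → Vec d) (l : Fin n → Fin K) (v : Vars d m J K) : Prop :=
  Feasible X f dom S N r ε T D l v ∧
    ∀ v', Feasible X f dom S N r ε T D l v' → v.objective l ≤ v'.objective l

end Program

/-! ### The asymptotic bounds -/

section Bounds

variable {d m J K : ℕ}

open Classical in
/-- `max_j M_j W_{⋆,1}^K`, and `∞` if the pieces are not Lipschitz with these constants. -/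
def lipTerm (X : Set (Vec m)) (f : Fin J → Vec d → Vec m → EReal) (dom : Set (Vec d))
    (M : Fin J → ℝ≥0) (P : Measure (Vec d)) (T : Fin K → Set (Vec d)) : ℝ≥0∞ :=
  if LipschitzPieces X f dom M then (⨆ j, (M j : ℝ≥0∞)) * limitWass 1 P T else ⊤

open Classical in
/-- `max_j (L_j / 2) D²`, and `∞` if the pieces are not smooth with these constants. -/
def smoothTerm (X : Set (Vec m)) (f : Fin J → Vec d → Vec m → EReal) (dom : Set (Vec d))
    (L : Fin J → ℝ≥0) (D : ℝ≥0∞) : ℝ≥0∞ :=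
  if SmoothPieces X f dom L then (⨆ j, (L j : ℝ≥0∞) / 2) * D ^ 2 else ⊤

/-- The upper bound `ψ̄_⋆^K`. -/
def psiUpper (X : Set (Vec m)) (f : Fin J → Vec d → Vec m → EReal) (dom : Set (Vec d))
    (M L : Fin J → ℝ≥0) (P : Measure (Vec d)) (T : Fin K → Set (Vec d)) : ℝ≥0∞ :=
  min (smoothTerm X f dom L (limitValue 2 P T)) (lipTerm X f dom M P T)

open Classical in
/-- `‖∇f(·, x̂)‖_{L₂(P_⋆^K)} W_{⋆,2}^K + (L/2) (W_{⋆,2}^K)²`, at its largest value over the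
accumulation points `x̂` of the sequence `x`; it is `∞` if `f` is not `L`-smooth. -/
def gradTerm (X : Set (Vec m)) (f : Fin J → Vec d → Vec m → EReal) (dom : Set (Vec d))
    (L₀ : ℝ≥0) (P : Measure (Vec d)) (T : Fin K → Set (Vec d)) (x : ℕ → Vec m) : ℝ≥0∞ :=
  if SmoothMax X f dom L₀ then
    ⨆ (xs : Vec m) (_ : MapClusterPt xs atTop x),
      eLpNorm (gradientWithin (fun u => (maxObj f u xs).toReal) dom) 2 (limitDist P T)
        * limitWass 2 P T + (L₀ : ℝ≥0∞) / 2 * limitWass 2 P T ^ 2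
  else ⊤

/-- The lower bound `ψ̲_⋆^K`; `Φ` is the sequence `Φ_t^K` and `x` the sequence `x_t^K`. -/
def psiLower (X : Set (Vec m)) (f : Fin J → Vec d → Vec m → EReal) (dom : Set (Vec d))
    (M : Fin J → ℝ≥0) (L₀ : ℝ≥0) (P : Measure (Vec d)) (T : Fin K → Set (Vec d))
    (Φ : ℕ → ℝ) (x : ℕ → Vec m) : EReal :=
  min (limsup (fun t => ((Φ t : ℝ) : EReal)) atTop)
    (min ((lipTerm X f dom M P T : ℝ≥0∞) : EReal)
      ((gradTerm X f dom L₀ P T x : ℝ≥0∞) : EReal))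

/-- `zs` is an accumulation point of the dual variables `z_t` (jointly in all `j` and all clusters
`k` in use) that achieves the limit superior of `Φ_t`: a subsequence of `z_t` converges to `zs` and
`Φ_t` converges along it to its limit superior. -/
def AchievesLimsup (T : Fin K → Set (Vec d)) (Φ : ℕ → ℝ) (z : ℕ → Fin J → Fin K → Vec d)
    (zs : Fin J → Fin K → Vec d) : Prop :=
  ∃ σ : ℕ → ℕ, StrictMono σ ∧
    (∀ j k, (T k).Nonempty → Tendsto (fun i => z (σ i) j k) atTop (𝓝 (zs j k))) ∧
    Tendsto (fun i => ((Φ (σ i) : ℝ) : EReal)) atTop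
      (𝓝 (limsup (fun t => ((Φ t : ℝ) : EReal)) atTop))

end Bounds

end ClusterDRO

end

/-! The supports at time `τ` are a function of the first `n₀ + τ` data points, and the later points
are independent of them. Freezing that prefix (`splice`) and applying the strong law to the rest
gives, for all `τ` at once, the convergence of cluster weights, means and values. In place of
equality of supports, `DataStable` compares them only at the data points: this is all that the
limits need, and it is a measurable event. Since means and dual variables depend on the data, the
law must be uniform in a parameter: a Lipschitz bound with integrable constant reduces it to a
countable dense set (`SupportRequirements.ae_tendsto_clusterAvg`).

For `p = 2`, every fixed set of centres does no better on the data than the optimal clustering. In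
the limit, along a minimizing sequence of centre sets, the value of the final supports is at most
the quantization error of `P`; the reverse holds because the limit means are themselves at most `K`
centres (`ae_limitValue_eq_quantError`).

For affine pieces and full support, finiteness of the conjugate and of the support function already
forces `z = -A_j x` (`Feasible.z_eq_neg`). Compactness of `X` then yields accumulation points, and
`SupportRequirements.ae_tendsto_phi` identifies `limitPhi` with the limit superior, which is one of
the entries of the lower bound. Cauchy-Schwarz gives `limitPhi_le`, a bound by the Lipschitz
constant times `limitValue 1`.

It remains to compare `limitValue 1` with `limitWass 1` (`ae_limitValue_le_limitWass`). Given a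
coupling of `P` with the limit distribution, draw i.i.d. pairs from it. Their first coordinates
continue the data stream; their second coordinates assign each point to clusters with the right
asymptotic weights and with average cost tending to that of the coupling. After a small correction
of the weights this is a coupling of the data with their clusters, hence no cheaper than the
clustering. -/

noncomputable section

namespace ClusterDRO

/-! ### Running means and splicing of data streams -/

section Averages

variable {F : Type*} [NormedAddCommGroup F] [NormedSpace ℝ F]

/-- The mean of the first `N` terms of a sequence. -/
def runningMean (x : ℕ → F) (N : ℕ) : F := (N : ℝ)⁻¹ • ∑ i ∈ Finset.range N, x i

lemma tendsto_runningMean_congr {x y : ℕ → F} {a : F} (n : ℕ) (h : ∀ i, n ≤ i → x i = y i)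
    (hx : Tendsto (runningMean x) atTop (𝓝 a)) : Tendsto (runningMean y) atTop (𝓝 a) := by
  have h0 : Tendsto (fun N : ℕ => (N : ℝ)⁻¹ • ∑ i ∈ Finset.range n, (y i - x i)) atTop (𝓝 0) := by
    simpa using (tendsto_inv_atTop_nhds_zero_nat (𝕜 := ℝ)).smul_const
      (∑ i ∈ Finset.range n, (y i - x i))
  have h1 := hx.add h0
  rw [add_zero] at h1
  refine h1.congr' ?_
  filter_upwards [eventually_ge_atTop n] with N hN
  have : ∑ i ∈ Finset.range N, (y i - x i) = ∑ i ∈ Finset.range n, (y i - x i) := by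
    refine (Finset.sum_subset (Finset.range_mono hN) fun i _ hi => ?_).symm
    rw [h i (by simpa using hi), sub_self]
  rw [runningMean, runningMean, ← smul_add, ← this, Finset.sum_sub_distrib]
  congr 1
  abel

variable {Ω : Type*}

/-- The stream that follows `ρ` for `n` terms and `ρ'` afterwards. -/
def splice (n : ℕ) (ρ ρ' : ℕ → Ω) : ℕ → Ω := fun i => if i < n then ρ i else ρ' i

lemma splice_splice (n : ℕ) (ρ ρ₁ ρ' : ℕ → Ω) :
    splice n (splice n ρ ρ₁) ρ' = splice n ρ ρ' := by
  ext i; by_cases h : i < n <;> simp [splice, h]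

variable [MeasurableSpace Ω]

lemma ae_tendsto_runningMean [CompleteSpace F] (Q : Measure Ω) [IsProbabilityMeasure Q]
    [MeasurableSpace F] [BorelSpace F] {g : Ω → F} (hg : Measurable g) (hint : Integrable g Q) :
    ∀ᵐ ρ ∂(Measure.infinitePi fun _ : ℕ => Q),
      Tendsto (runningMean fun i => g (ρ i)) atTop (𝓝 (∫ x, g x ∂Q)) := by
  have mp := fun i : ℕ => measurePreserving_eval_infinitePi (fun _ : ℕ => Q) i
  have h := ProbabilityTheory.strong_law_ae (μ := Measure.infinitePi fun _ : ℕ => Q)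
    (fun (i : ℕ) ρ => g (ρ i)) ((mp 0).integrable_comp_of_integrable hint)
    (fun i j hij => (ProbabilityTheory.iIndepFun_infinitePi (P := fun _ : ℕ => Q)
      (X := fun _ : ℕ => g) fun _ => hg).indepFun hij)
    (fun i => ⟨(hg.comp (measurable_pi_apply i)).aemeasurable,
      (hg.comp (measurable_pi_apply 0)).aemeasurable, by
        rw [show (fun ρ : ℕ → Ω => g (ρ i)) = g ∘ (Function.eval i) from rfl,
          show (fun ρ : ℕ → Ω => g (ρ 0)) = g ∘ (Function.eval 0) from rfl,
          ← Measure.map_map hg (measurable_pi_apply i), ← Measure.map_map hg (measurable_pi_apply 0),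
          (mp i).map_eq, (mp 0).map_eq]⟩)
  have he : ∫ ρ, g (ρ 0) ∂(Measure.infinitePi fun _ : ℕ => Q) = ∫ x, g x ∂Q := by
    have h2 := (mp 0).map_eq
    rw [← integral_map (φ := Function.eval 0) (f := g) (mp 0).measurable.aemeasurable (by
      rw [h2]; exact hint.aestronglyMeasurable), h2]
  rw [he] at h
  exact h

lemma measurable_splice (n : ℕ) :
    Measurable fun w : (ℕ → Ω) × (ℕ → Ω) => splice n w.1 w.2 := by
  refine measurable_pi_lambda _ fun i => ?_
  by_cases h : i < n
  · simp only [splice, h, if_true]; fun_prop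
  · simp only [splice, h, if_false]; fun_prop

/-- The preimage of a cylinder is a rectangle: indices below `n` constrain one stream, the others
constrain the other. -/
lemma measurePreserving_splice (Q : Measure Ω) [IsProbabilityMeasure Q] (n : ℕ) :
    MeasurePreserving (fun w : (ℕ → Ω) × (ℕ → Ω) => splice n w.1 w.2)
      ((Measure.infinitePi fun _ : ℕ => Q).prod (Measure.infinitePi fun _ : ℕ => Q))
      (Measure.infinitePi fun _ : ℕ => Q) := by
  refine ⟨measurable_splice n, Measure.eq_infinitePi _ fun s t ht => ?_⟩
  rw [Measure.map_apply (measurable_splice n)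
    (MeasurableSet.pi s.countable_toSet fun i _ => ht i)]
  have : (fun w : (ℕ → Ω) × (ℕ → Ω) => splice n w.1 w.2) ⁻¹' (Set.pi s t)
      = (Set.pi (s.filter (· < n)) t) ×ˢ (Set.pi (s.filter (¬ · < n)) t) := by
    ext w
    simp only [Set.mem_preimage, Set.mem_pi, Set.mem_prod, splice, Finset.coe_filter,
      Set.mem_ofPred_eq, Finset.mem_coe]
    constructor
    · exact fun h => ⟨fun i hi => by simpa [hi.2] using h i hi.1,
        fun i hi => by simpa [hi.2] using h i hi.1⟩
    · intro h i hi
      by_cases hn : i < n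
      · simpa [hn] using h.1 i ⟨hi, hn⟩
      · simpa [hn] using h.2 i ⟨hi, hn⟩
  rw [this, Measure.prod_prod, Measure.infinitePi_pi _ fun i _ => ht i,
    Measure.infinitePi_pi _ fun i _ => ht i, Finset.prod_filter_mul_prod_filter_not]

variable (Q : Measure Ω) [IsProbabilityMeasure Q]

/-- Stands in for conditioning on the first `n` terms: the prefix is frozen and the tail resampled.
-/
lemma ae_of_ae_ae_splice (n : ℕ) {p : (ℕ → Ω) → Prop} (hp : MeasurableSet {ρ | p ρ})
    (h : ∀ᵐ ρ ∂(Measure.infinitePi fun _ : ℕ => Q), ∀ᵐ ρ' ∂(Measure.infinitePi fun _ : ℕ => Q),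
      p (splice n ρ ρ')) : ∀ᵐ ρ ∂(Measure.infinitePi fun _ : ℕ => Q), p ρ := by
  rw [← (measurePreserving_splice Q n).map_eq, ae_map_iff (measurable_splice n).aemeasurable hp]
  exact (Measure.ae_prod_iff_ae_ae (measurable_splice n hp)).2 h

lemma ae_ae_splice (n : ℕ) {p : (ℕ → Ω) → Prop}
    (h : ∀ᵐ ρ ∂(Measure.infinitePi fun _ : ℕ => Q), p ρ) :
    ∀ᵐ ρ ∂(Measure.infinitePi fun _ : ℕ => Q), ∀ᵐ ρ' ∂(Measure.infinitePi fun _ : ℕ => Q),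
      p (splice n ρ ρ') :=
  Measure.ae_ae_of_ae_prod ((measurePreserving_splice Q n).quasiMeasurePreserving.ae h)

/-- Almost surely, a stream in `R` has the property that `R` has positive probability given its
first `n` terms. -/
lemma ae_mem_imp_splice_ne_zero (n : ℕ) {R : Set (ℕ → Ω)} (hR : MeasurableSet R) :
    ∀ᵐ ρ ∂(Measure.infinitePi fun _ : ℕ => Q), ρ ∈ R →
      (Measure.infinitePi fun _ : ℕ => Q) {ρ' | splice n ρ ρ' ∈ R} ≠ 0 := by
  have hm : Measurable fun ρ : ℕ → Ω =>
      (Measure.infinitePi fun _ : ℕ => Q) {ρ' | splice n ρ ρ' ∈ R} :=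
    measurable_measure_prodMk_left (measurable_splice n hR)
  refine ae_of_ae_ae_splice Q n ?_ (Eventually.of_forall fun ρ => ?_)
  · exact hR.imp (hm (measurableSet_singleton 0)).compl
  -- The conditional probability depends on the prefix alone, so resampling the tail leaves it
  -- unchanged; if it is zero, the new tail almost surely leaves `R`.
  · simp only [splice_splice]
    by_cases h : (Measure.infinitePi fun _ : ℕ => Q) {ρ' | splice n ρ ρ' ∈ R} = 0
    · filter_upwards [measure_eq_zero_iff_ae_notMem.1 h] with ρ' h1 h2
      exact absurd h2 h1
    · exact Eventually.of_forall fun _ _ => h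

end Averages

/-! ### Strong laws and null sets that depend on a prefix of the data -/

section ParametricLaw

variable {d : ℕ} (P : Measure (Vec d)) [IsProbabilityMeasure P]

lemma measurable_dataset (n : ℕ) : Measurable (dataset (d := d) n) :=
  measurable_pi_lambda _ fun i => measurable_pi_apply (i : ℕ)

lemma dataset_splice (n : ℕ) (ω ω' : ℕ → Vec d) : dataset n (splice n ω ω') = dataset n ω := by
  ext i : 1; simp [dataset, splice]

/-- The strong law for summands that depend on the first `n` data points. -/
lemma ae_tendsto_runningMean_dataset {F : Type*} [NormedAddCommGroup F] [NormedSpace ℝ F]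
    [CompleteSpace F] [MeasurableSpace F] [BorelSpace F] [SecondCountableTopology F] (n : ℕ)
    {h : (Fin n → Vec d) → Vec d → F} (hm : Measurable (Function.uncurry h))
    (hint : ∀ a, Integrable (h a) P) :
    ∀ᵐ ω ∂(streamLaw P), Tendsto (runningMean fun i => h (dataset n ω) (ω i)) atTop
      (𝓝 (∫ u, h (dataset n ω) u ∂P)) := by
  have hI : Measurable fun a => ∫ u, h a u ∂P :=
    (hm.stronglyMeasurable.integral_prod_right').measurable
  have hmean : ∀ N, Measurable fun ω : ℕ → Vec d =>
      runningMean (fun i => h (dataset n ω) (ω i)) N := fun N => by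
    refine Measurable.const_smul (Finset.measurable_sum _ fun i _ => ?_) _
    exact hm.comp ((measurable_dataset n).prodMk (measurable_pi_apply i))
  refine ae_of_ae_ae_splice P n ?_ (Eventually.of_forall fun ω => ?_)
  -- The limit varies with `ω`; subtracting it leaves convergence to a fixed point, which is a
  -- measurable event.
  · have : {ω : ℕ → Vec d | Tendsto (runningMean fun i => h (dataset n ω) (ω i)) atTop
        (𝓝 (∫ u, h (dataset n ω) u ∂P))} = {ω : ℕ → Vec d | Tendsto (fun N =>
          runningMean (fun i => h (dataset n ω) (ω i)) N - ∫ u, h (dataset n ω) u ∂P) atTop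
            (𝓝 0)} := by
      ext ω
      exact tendsto_sub_nhds_zero_iff.symm
    rw [this]
    exact measurableSet_tendsto _ fun N => (hmean N).sub (hI.comp (measurable_dataset n))
  · filter_upwards [ae_tendsto_runningMean P (hm.comp measurable_prodMk_left) (hint (dataset n ω))]
      with ω' hω'
    rw [dataset_splice]
    refine tendsto_runningMean_congr n (fun i hi => ?_) hω'
    simp only [splice, not_lt.2 hi, if_false]; rfl

/-- Data points after the first `n` avoid null sets that depend on the first `n` data points. -/
lemma ae_notMem_dataset (n : ℕ) {N : Set ((Fin n → Vec d) × Vec d)} (hN : MeasurableSet N)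
    (h0 : ∀ a, P {u | (a, u) ∈ N} = 0) :
    ∀ᵐ ω ∂(streamLaw P), ∀ i, n ≤ i → (dataset n ω, ω i) ∉ N := by
  refine ae_all_iff.2 fun i => ?_
  by_cases hi : n ≤ i
  · have : ∀ᵐ ω ∂(streamLaw P), (dataset n ω, ω i) ∉ N := by
      refine ae_of_ae_ae_splice P n ?_ (Eventually.of_forall fun ω => ?_)
      · exact ((measurable_dataset n).prodMk (measurable_pi_apply i)) hN.compl
      · simp only [dataset_splice]
        have := (measurePreserving_eval_infinitePi (fun _ : ℕ => P) i).quasiMeasurePreserving.ae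
          (measure_eq_zero_iff_ae_notMem.1 (h0 (dataset n ω)))
        filter_upwards [this] with ω' hω'
        simpa [splice, not_lt.2 hi] using hω'
    filter_upwards [this] with ω hω _ using hω
  · exact Eventually.of_forall fun _ h => absurd h hi

end ParametricLaw


/-! ### Uniform strong law over a family of summands -/

section UniformLaw

variable {F Θ : Type*} [NormedAddCommGroup F] [NormedSpace ℝ F] [NormedAddCommGroup Θ]

/-- Moving the parameter to a nearby dense point costs its distance times the average of `b`, which
stays bounded, so convergence at countably many parameters suffices. -/
lemma tendsto_runningMean_of_dense {ι : Type*} {l : Filter ι} {N : ι → ℕ} (hN : Tendsto N l atTop)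
    {H : Θ → ℕ → F} {b : ℕ → ℝ} {B : ℝ} {I : Θ → F} {q : ℕ → Θ} (hq : DenseRange q)
    (hH : ∀ θ θ' i, ‖H θ i - H θ' i‖ ≤ ‖θ - θ'‖ * (1 + ‖θ‖ + ‖θ'‖) * b i)
    (hI : ∀ θ θ', ‖I θ - I θ'‖ ≤ ‖θ - θ'‖ * (1 + ‖θ‖ + ‖θ'‖) * B)
    (hb : Tendsto (runningMean b) atTop (𝓝 B))
    (hlim : ∀ n, Tendsto (runningMean (H (q n))) atTop (𝓝 (I (q n))))
    {θ : ι → Θ} {θ₀ : Θ} (hθ : Tendsto θ l (𝓝 θ₀)) :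
    Tendsto (fun i => runningMean (H (θ i)) (N i)) l (𝓝 (I θ₀)) := by
  rw [Metric.tendsto_nhds]
  intro ε hε
  -- The factor 2 pays for the replacement twice: in the running mean and in the limit.
  have hopen : IsOpen {θ' : Θ | 2 * (‖θ₀ - θ'‖ * (1 + ‖θ₀‖ + ‖θ'‖) * B) < ε} :=
    isOpen_lt (by fun_prop) continuous_const
  obtain ⟨n, hn⟩ := hq.exists_mem_open hopen ⟨θ₀, by simpa using hε⟩
  have h1 : Tendsto (fun i => ‖θ i - q n‖ * (1 + ‖θ i‖ + ‖q n‖) * runningMean b (N i)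
      + ‖runningMean (H (q n)) (N i) - I (q n)‖ + ‖θ₀ - q n‖ * (1 + ‖θ₀‖ + ‖q n‖) * B) l
      (𝓝 (‖θ₀ - q n‖ * (1 + ‖θ₀‖ + ‖q n‖) * B + ‖I (q n) - I (q n)‖
        + ‖θ₀ - q n‖ * (1 + ‖θ₀‖ + ‖q n‖) * B)) := by
    refine Tendsto.add (Tendsto.add (Tendsto.mul (Tendsto.mul (hθ.sub_const _).norm ?_)
      (hb.comp hN)) (((hlim n).comp hN).sub_const _).norm) tendsto_const_nhds
    exact (hθ.norm.const_add 1).add_const _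
  filter_upwards [h1.eventually_lt_const (show _ < ε by
    simp only [sub_self, norm_zero, add_zero]; rw [← two_mul]; exact hn)] with i hi
  refine lt_of_le_of_lt ?_ hi
  have h2 : ‖runningMean (H (θ i)) (N i) - runningMean (H (q n)) (N i)‖
      ≤ ‖θ i - q n‖ * (1 + ‖θ i‖ + ‖q n‖) * runningMean b (N i) := by
    rw [runningMean, runningMean, ← smul_sub, ← Finset.sum_sub_distrib, runningMean, norm_smul,
      norm_inv, Real.norm_natCast, smul_eq_mul, mul_left_comm]
    refine mul_le_mul_of_nonneg_left ?_ (by positivity)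
    rw [Finset.mul_sum]
    exact (norm_sum_le _ _).trans (Finset.sum_le_sum fun j _ => hH _ _ _)
  have h3 := hI (q n) θ₀
  rw [dist_eq_norm]
  calc ‖runningMean (H (θ i)) (N i) - I θ₀‖
      = ‖(runningMean (H (θ i)) (N i) - runningMean (H (q n)) (N i))
        + (runningMean (H (q n)) (N i) - I (q n)) + (I (q n) - I θ₀)‖ := by congr 1; abel
    _ ≤ _ := norm_add₃_le
    _ ≤ _ := by
      refine add_le_add (add_le_add h2 le_rfl) (h3.trans_eq ?_)
      rw [norm_sub_rev]; ring

end UniformLaw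

/-! ### Clusters along a data stream -/

section Clusters

variable {d K n₀ : ℕ} {F : Type*} [NormedAddCommGroup F] [NormedSpace ℝ F]

/-- The part of the mean of the first `n` terms of a sequence that is due to cluster `k`. -/
def clusterAvg {n : ℕ} (l : Fin n → Fin K) (k : Fin K) (x : ℕ → F) : F :=
  (n : ℝ)⁻¹ • ∑ i ∈ Finset.univ.filter (l · = k), x i

/-- Eventually, the label of a data point is determined by the set that contains it. -/
structure LabelsMatch (T : Fin K → Set (Vec d)) (ω : ℕ → Vec d)
    (l : (t : ℕ) → Fin (n₀ + t) → Fin K) (τ : ℕ) : Prop where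
  mem : ∀ t ≥ τ, ∀ i : Fin (n₀ + t), ω i ∈ T (l t i)
  unique : ∀ i, n₀ + τ ≤ i → ∀ k k', ω i ∈ T k → ω i ∈ T k' → k = k'

variable {T : Fin K → Set (Vec d)} {ω : ℕ → Vec d} {l : (t : ℕ) → Fin (n₀ + t) → Fin K} {τ : ℕ}

/-- From index `n₀ + τ` on, label `k` and membership in `T k` agree; only the earlier terms can
differ. -/
lemma LabelsMatch.norm_clusterAvg_sub_le (h : LabelsMatch T ω l τ) {t : ℕ} (ht : τ ≤ t) (k : Fin K)
    (g : Vec d → F) :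
    ‖clusterAvg (l t) k (fun i => g (ω i)) - runningMean (fun i => (T k).indicator g (ω i)) (n₀ + t)‖
      ≤ ((n₀ + t : ℕ) : ℝ)⁻¹ * ∑ i ∈ Finset.range (n₀ + τ), ‖g (ω i)‖ := by
  classical
  have hsub : Finset.range (n₀ + τ) ⊆ Finset.range (n₀ + t) := Finset.range_mono (by omega)
  rw [clusterAvg, runningMean, ← smul_sub, norm_smul, norm_inv, Real.norm_natCast]
  refine mul_le_mul_of_nonneg_left ?_ (by positivity)
  have h1 : ∑ i ∈ Finset.range (n₀ + τ), ‖g (ω i)‖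
      = ∑ i : Fin (n₀ + t), if (i : ℕ) < n₀ + τ then ‖g (ω i)‖ else 0 := by
    rw [← Finset.sum_range fun i => if i < n₀ + τ then ‖g (ω i)‖ else 0,
      ← Finset.sum_subset hsub]
    · exact Finset.sum_congr rfl fun i hi => by simp [Finset.mem_range.1 hi]
    · intro i _ hi
      simpa using fun h => absurd h (by simpa using hi)
  rw [h1, Finset.sum_filter, Finset.sum_range, ← Finset.sum_sub_distrib]
  refine (norm_sum_le _ _).trans (Finset.sum_le_sum fun i _ => ?_)
  have hm := h.mem t ht i
  by_cases hi : (i : ℕ) < n₀ + τ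
  · by_cases h1 : l t i = k <;> by_cases h2 : ω i ∈ T k <;> simp [hi, h1, h2]
  · have : l t i = k ↔ ω i ∈ T k :=
      ⟨fun e => e ▸ hm, fun e => h.unique i (not_lt.1 hi) _ _ hm e⟩
    by_cases h2 : ω i ∈ T k
    · simp [hi, this.2 h2, h2]
    · simp [hi, h2, mt this.1 h2]

lemma LabelsMatch.tendsto_clusterAvg (h : LabelsMatch T ω l τ) {σ : ℕ → ℕ}
    (hσ : Tendsto σ atTop atTop) (k : Fin K) {g : ℕ → Vec d → F} {g₀ : Vec d → F} {a : F}
    (hg : ∀ u, Tendsto (fun s => g s u) atTop (𝓝 (g₀ u)))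
    (ha : Tendsto (fun s => runningMean (fun i => (T k).indicator (g s) (ω i)) (n₀ + σ s)) atTop
      (𝓝 a)) :
    Tendsto (fun s => clusterAvg (l (σ s)) k (fun i => g s (ω i))) atTop (𝓝 a) := by
  have h0 : Tendsto (fun s => ((n₀ + σ s : ℕ) : ℝ)⁻¹ * ∑ i ∈ Finset.range (n₀ + τ), ‖g s (ω i)‖)
      atTop (𝓝 (0 * ∑ i ∈ Finset.range (n₀ + τ), ‖g₀ (ω i)‖)) := by
    refine Tendsto.mul ?_ (tendsto_finsetSum _ fun i _ => (hg _).norm)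
    exact (tendsto_inv_atTop_nhds_zero_nat (𝕜 := ℝ)).comp
      (tendsto_atTop_mono (fun s => Nat.le_add_left _ n₀) hσ)
  rw [zero_mul] at h0
  have h1 := squeeze_zero_norm' (f := fun s => clusterAvg (l (σ s)) k (fun i => g s (ω i))
    - runningMean (fun i => (T k).indicator (g s) (ω i)) (n₀ + σ s)) (by
      filter_upwards [hσ.eventually_ge_atTop τ] with s hs
      exact h.norm_clusterAvg_sub_le hs k (g s)) h0
  simpa using h1.add ha

/-- On the data seen so far, the supports have not changed since time `τ`. -/
def DataStable (C : ClusteringRule d n₀ K) (ω : ℕ → Vec d) (τ : ℕ) : Prop :=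
  ∀ t ≥ τ, ∀ k, ∀ i < n₀ + t, (ω i ∈ C.suppAt ω t k ↔ ω i ∈ C.suppAt ω τ k)

/-- Measurable sets that partition the space up to null sets, each of them empty or of positive
measure. -/
structure AdmissiblePartition (P : Measure (Vec d)) (T : Fin K → Set (Vec d)) : Prop where
  measurable : ∀ k, MeasurableSet (T k)
  pos : ∀ k, (T k).Nonempty → 0 < P (T k)
  null : ∀ k k', k ≠ k' → P (T k ∩ T k') = 0
  cover : ∀ᵐ u ∂P, ∃ k, u ∈ T k

lemma measure_inter_eq_zero_of_frontier {P : Measure (Vec d)} {A B : Set (Vec d)}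
    (h : interior A ∩ interior B = ∅)
    (hA : P (frontier A) = 0) (hB : P (frontier B) = 0) : P (A ∩ B) = 0 := by
  refine measure_mono_null (fun u hu => ?_) (measure_union_null hA hB)
  by_contra hc
  simp only [Set.mem_union, frontier, Set.mem_sdiff, not_or, not_and, not_not] at hc
  have : u ∈ interior A ∩ interior B := ⟨hc.1 (subset_closure hu.1), hc.2 (subset_closure hu.2)⟩
  simp [h] at this

/-- A family of integrable summands that is locally Lipschitz in the parameter. -/
structure LipschitzFamily {F Θ : Type*} [NormedAddCommGroup F] [MeasurableSpace F]
    [NormedAddCommGroup Θ] (P : Measure (Vec d)) (G : Θ → Vec d → F) : Prop where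
  measurable : ∀ θ, Measurable (G θ)
  integrable : ∀ θ, Integrable (G θ) P
  lipschitz : ∀ θ θ' u, ‖G θ u - G θ' u‖ ≤ ‖θ - θ'‖ * (1 + ‖θ‖ + ‖θ'‖) * (2 * ‖u‖ + 1)

lemma LipschitzFamily.tendsto {F Θ : Type*} [NormedAddCommGroup F] [MeasurableSpace F]
    [NormedAddCommGroup Θ] {P : Measure (Vec d)} {G : Θ → Vec d → F} (hG : LipschitzFamily P G)
    {θ : ℕ → Θ} {θ₀ : Θ} (hθ : Tendsto θ atTop (𝓝 θ₀)) (u : Vec d) :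
    Tendsto (fun s => G (θ s) u) atTop (𝓝 (G θ₀ u)) := by
  rw [tendsto_iff_norm_sub_tendsto_zero]
  have h : Tendsto (fun s => ‖θ s - θ₀‖ * (1 + ‖θ s‖ + ‖θ₀‖) * (2 * ‖u‖ + 1)) atTop
      (𝓝 (‖θ₀ - θ₀‖ * (1 + ‖θ₀‖ + ‖θ₀‖) * (2 * ‖u‖ + 1))) :=
    (((hθ.sub_const θ₀).norm).mul ((hθ.norm.const_add 1).add_const _)).mul_const _
  rw [sub_self, norm_zero, zero_mul, zero_mul] at h
  exact squeeze_zero (fun s => norm_nonneg _) (fun s => hG.lipschitz _ _ _) h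

variable {P : Measure (Vec d)} [IsProbabilityMeasure P] {S : Set (Vec d)}
  {C : ClusteringRule d n₀ K}

lemma SupportRequirements.ae_admissible (hC : SupportRequirements P S C)
    (hS : ∀ᵐ u ∂P, u ∈ S) :
    ∀ᵐ ω ∂(streamLaw P), ∀ t, AdmissiblePartition P (C.suppAt ω t) := by
  filter_upwards [hC.disjoint_interior, hC.cover, hC.pos, hC.boundary_null] with ω h1 h2 h3 h4 t
  refine ⟨fun k => measurable_prodMk_left (hC.measurable t k), h3 t, fun k k' hk =>
    measure_inter_eq_zero_of_frontier (h1 t k k' hk) (h4 t k) (h4 t k'), ?_⟩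
  filter_upwards [hS] with u hu
  rw [← h2 t] at hu
  exact Set.mem_iUnion.1 hu

/-- The overlaps of the supports at time `τ` are null and depend on the first `n₀ + τ` points, so
later points avoid them. Earlier points may lie in several supports and change labels. -/
lemma SupportRequirements.ae_labelsMatch (hC : SupportRequirements P S C)
    (hS : ∀ᵐ u ∂P, u ∈ S) :
    ∀ᵐ ω ∂(streamLaw P), ∀ τ, DataStable C ω τ →
      LabelsMatch (C.suppAt ω τ) ω (fun t => C.labelAt ω t) τ := by
  -- The second conjunct discards prefixes whose overlap is not null, so that every section of this
  -- set is null.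
  have hN : ∀ᵐ ω ∂(streamLaw P), ∀ τ k k', ∀ i, n₀ + τ ≤ i →
      (dataset (n₀ + τ) ω, ω i) ∉ {w : (Fin (n₀ + τ) → Vec d) × Vec d |
        w.2 ∈ C.supp τ w.1 k ∩ C.supp τ w.1 k' ∧
          P {u | (w.1, u) ∈ {w : (Fin (n₀ + τ) → Vec d) × Vec d |
            w.2 ∈ C.supp τ w.1 k ∩ C.supp τ w.1 k'}} = 0} := by
    refine ae_all_iff.2 fun τ => ae_all_iff.2 fun k => ae_all_iff.2 fun k' => ?_
    have hm : MeasurableSet {w : (Fin (n₀ + τ) → Vec d) × Vec d |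
        w.2 ∈ C.supp τ w.1 k ∩ C.supp τ w.1 k'} :=
      (hC.measurable τ k).inter (hC.measurable τ k')
    refine ae_notMem_dataset P _ ?_ fun a => ?_
    · exact hm.inter (((measurable_measure_prodMk_left hm).comp measurable_fst)
        (measurableSet_singleton 0))
    · by_cases h : P {u | (a, u) ∈ {w : (Fin (n₀ + τ) → Vec d) × Vec d |
          w.2 ∈ C.supp τ w.1 k ∩ C.supp τ w.1 k'}} = 0
      · exact measure_mono_null (fun u hu => hu.1) h
      · refine measure_mono_null (fun u hu => ?_) (measure_empty (μ := P))
        exact absurd hu.2 h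
  filter_upwards [hN, hC.label_mem, hC.ae_admissible hS] with ω h1 h2 h3 τ hst
  refine ⟨fun t ht i => (hst t ht _ i i.2).1 (h2 t i), fun i hi k k' hk hk' => ?_⟩
  by_contra hne
  exact h1 τ k k' i hi ⟨⟨hk, hk'⟩, (h3 τ).null k k' hne⟩

variable [CompleteSpace F] [MeasurableSpace F] [BorelSpace F] [SecondCountableTopology F]
  {Θ : Type*} [NormedAddCommGroup Θ] [TopologicalSpace.SeparableSpace Θ]

/-- One null set serves all `τ`, subsequences and parameter sequences, so the parameters may be
computed from the data. -/
lemma SupportRequirements.ae_tendsto_clusterAvg (hC : SupportRequirements P S C)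
    (hS : ∀ᵐ u ∂P, u ∈ S) (hP : Integrable (fun u : Vec d => u) P) {G : Θ → Vec d → F}
    (hG : LipschitzFamily P G) :
    ∀ᵐ ω ∂(streamLaw P), ∀ τ, DataStable C ω τ → ∀ (σ : ℕ → ℕ), Tendsto σ atTop atTop →
      ∀ (k : Fin K) (θ : ℕ → Θ) (θ₀ : Θ), Tendsto θ atTop (𝓝 θ₀) →
        Tendsto (fun s => clusterAvg (C.labelAt ω (σ s)) k (fun i => G (θ s) (ω i))) atTop
          (𝓝 (∫ u in C.suppAt ω τ k, G θ₀ u ∂P)) := by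
  have hbi : Integrable (fun u : Vec d => 2 * ‖u‖ + 1) P :=
    (hP.norm.const_mul 2).add (integrable_const 1)
  have hb := ae_tendsto_runningMean P (g := fun u : Vec d => 2 * ‖u‖ + 1) (by fun_prop) hbi
  have hd : ∀ᵐ ω ∂(streamLaw P), ∀ (τ : ℕ) (k : Fin K) (n : ℕ),
      Tendsto (runningMean fun i =>
        (C.suppAt ω τ k).indicator (G (TopologicalSpace.denseSeq Θ n)) (ω i)) atTop
        (𝓝 (∫ u, (C.suppAt ω τ k).indicator (G (TopologicalSpace.denseSeq Θ n)) u ∂P)) := by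
    refine ae_all_iff.2 fun τ => ae_all_iff.2 fun k => ae_all_iff.2 fun n => ?_
    refine ae_tendsto_runningMean_dataset P (n₀ + τ)
      (h := fun a => (C.supp τ a k).indicator (G (TopologicalSpace.denseSeq Θ n))) ?_ fun a => ?_
    · exact ((hG.measurable (TopologicalSpace.denseSeq Θ n)).comp measurable_snd).indicator
        (hC.measurable τ k)
    · exact (hG.integrable _).indicator (measurable_prodMk_left (hC.measurable τ k))
  filter_upwards [hb, hd, hC.ae_labelsMatch hS, hC.ae_admissible hS]
    with ω hb hd hl hadm τ hst σ hσ k θ θ₀ hθ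
  have hTm := (hadm τ).measurable k
  refine (hl τ hst).tendsto_clusterAvg hσ k (hG.tendsto hθ) ?_
  rw [← integral_indicator hTm]
  refine tendsto_runningMean_of_dense (I := fun θ => ∫ u, (C.suppAt ω τ k).indicator (G θ) u ∂P)
    (H := fun θ i => (C.suppAt ω τ k).indicator (G θ) (ω i))
    (tendsto_atTop_mono (fun s => Nat.le_add_left _ n₀) hσ) (TopologicalSpace.denseRange_denseSeq Θ)
    (fun θ θ' i => ?_) (fun θ θ' => ?_) hb (hd τ k) hθ
  · by_cases h : ω i ∈ C.suppAt ω τ k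
    · simpa [h] using hG.lipschitz θ θ' (ω i)
    · simp only [h, not_false_eq_true, Set.indicator_of_notMem, sub_self, norm_zero]
      positivity
  · rw [← integral_sub ((hG.integrable θ).indicator hTm) ((hG.integrable θ').indicator hTm),
      ← integral_const_mul]
    refine norm_integral_le_of_norm_le (hbi.const_mul _) (Eventually.of_forall fun u => ?_)
    by_cases h : u ∈ C.suppAt ω τ k
    · simpa [h] using hG.lipschitz θ θ' u
    · simp only [h, not_false_eq_true, Set.indicator_of_notMem, sub_self, norm_zero]
      positivity

end Clusters


/-! ### Limits of cluster weights, means and values -/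

section Limits

variable {d K n₀ : ℕ} {P : Measure (Vec d)}

lemma lipschitzFamily_const_one [IsFiniteMeasure P] :
    LipschitzFamily P (fun (_ : ℝ) (_ : Vec d) => (1 : ℝ)) where
  measurable _ := measurable_const
  integrable _ := integrable_const _
  lipschitz _ _ _ := by rw [sub_self, norm_zero]; positivity

lemma lipschitzFamily_id (hP : Integrable (fun u : Vec d => u) P) :
    LipschitzFamily P (fun (_ : ℝ) (u : Vec d) => u) where
  measurable _ := measurable_id
  integrable _ := hP
  lipschitz _ _ _ := by rw [sub_self, norm_zero]; positivity

lemma lipschitzFamily_norm_sub_rpow [IsFiniteMeasure P] (hP : MemLp (fun u : Vec d => u) 2 P)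
    {p : ℝ} (hp : p = 1 ∨ p = 2) :
    LipschitzFamily P (fun (θ u : Vec d) => ‖u - θ‖ ^ p) := by
  refine ⟨fun θ => by fun_prop, fun θ => ?_, fun θ θ' u => ?_⟩
  · have h : MemLp (fun u : Vec d => u - θ) 2 P := hP.sub (memLp_const θ)
    rcases hp with rfl | rfl
    · simpa using (h.integrable one_le_two).norm
    · simpa using h.integrable_norm_pow two_ne_zero
  · have h0 : |‖u - θ‖ - ‖u - θ'‖| ≤ ‖θ - θ'‖ := by
      refine (abs_norm_sub_norm_le _ _).trans_eq ?_
      rw [sub_sub_sub_cancel_left, norm_sub_rev]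
    rcases hp with rfl | rfl
    · simp only [Real.rpow_one, Real.norm_eq_abs]
      refine h0.trans ?_
      rw [mul_assoc]
      refine le_mul_of_one_le_right (norm_nonneg _) (one_le_mul_of_one_le_of_one_le ?_ ?_) <;>
      · have := norm_nonneg u; have := norm_nonneg θ; have := norm_nonneg θ'; linarith
    · simp only [Real.rpow_ofNat, Real.norm_eq_abs]
      have h1 := norm_sub_le u θ
      have h2 := norm_sub_le u θ'
      -- The sum of the two norms is at most `2‖u‖ + ‖θ‖ + ‖θ'‖`, the source of the shape of the
      -- bound in `LipschitzFamily`.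
      rw [sq_sub_sq, abs_mul, mul_comm, mul_assoc]
      refine mul_le_mul h0 ?_ (abs_nonneg _) (norm_nonneg _)
      rw [abs_of_nonneg (by positivity)]
      nlinarith [norm_nonneg u, norm_nonneg θ, norm_nonneg θ',
        mul_nonneg (norm_nonneg u) (norm_nonneg θ), mul_nonneg (norm_nonneg u) (norm_nonneg θ')]

lemma clusterAvg_one {n : ℕ} (l : Fin n → Fin K) (k : Fin K) :
    clusterAvg l k (fun _ => (1 : ℝ)) = (clusterCard l k : ℝ) / n := by
  simp [clusterAvg, clusterCard, div_eq_inv_mul]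

lemma clusterMean_eq {n : ℕ} (hn : 0 < n) (l : Fin n → Fin K) (k : Fin K) (ω : ℕ → Vec d) :
    clusterMean (dataset n ω) l k = ((clusterCard l k : ℝ) / n)⁻¹ • clusterAvg l k ω := by
  have : (n : ℝ) ≠ 0 := by positivity
  rw [clusterMean, clusterAvg, smul_smul, inv_div, div_mul_eq_mul_div, mul_inv_cancel₀ this,
    one_div]
  rfl

lemma ofReal_norm_rpow {p : ℝ} (hp : 0 ≤ p) (x : Vec d) :
    ENNReal.ofReal (‖x‖ ^ p) = ‖x‖ₑ ^ p := by
  rw [← ENNReal.ofReal_rpow_of_nonneg (norm_nonneg x) hp, ofReal_norm]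

lemma clusterValue_eq {n : ℕ} (hn : 0 < n) {p : ℝ} (hp : 0 ≤ p) (ω : ℕ → Vec d)
    (l : Fin n → Fin K) :
    clusterValue p (dataset n ω) l = (ENNReal.ofReal (∑ k, clusterAvg l k
      (fun i => ‖ω i - clusterMean (dataset n ω) l k‖ ^ p))) ^ (1 / p) := by
  rw [clusterValue]
  congr 1
  simp only [clusterAvg, smul_eq_mul]
  rw [← Finset.mul_sum, ENNReal.ofReal_mul (by positivity),
    ENNReal.ofReal_inv_of_pos (by positivity), ENNReal.ofReal_natCast,
    ENNReal.ofReal_sum_of_nonneg fun k _ => Finset.sum_nonneg fun i _ => by positivity]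
  congr 1
  refine Finset.sum_congr rfl fun k _ => ?_
  rw [ENNReal.ofReal_sum_of_nonneg fun i _ => by positivity]
  exact Finset.sum_congr rfl fun i _ => (ofReal_norm_rpow hp _).symm

lemma limitValue_eq {p : ℝ} (hp : 0 ≤ p) {T : Fin K → Set (Vec d)}
    (hT : ∀ k, MeasurableSet (T k)) (hint : ∀ θ : Vec d, Integrable (fun u => ‖u - θ‖ ^ p) P) :
    limitValue p P T
      = (ENNReal.ofReal (∑ k, ∫ u in T k, ‖u - limitMean P T k‖ ^ p ∂P)) ^ (1 / p) := by
  rw [limitValue, lintegral_finsetSum _ fun k _ => Measurable.indicator (by fun_prop) (hT k),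
    ENNReal.ofReal_sum_of_nonneg fun k _ => integral_nonneg fun u => by positivity]
  congr 1
  refine Finset.sum_congr rfl fun k _ => ?_
  rw [lintegral_indicator (hT k), ofReal_integral_eq_lintegral_ofReal (hint _).restrict
    (Eventually.of_forall fun u => by positivity)]
  simp only [ofReal_norm_rpow hp]

lemma AdmissiblePartition.limitMean_eq_zero {T : Fin K → Set (Vec d)} {k : Fin K}
    (hk : ¬ (T k).Nonempty) : limitMean P T k = 0 := by
  rw [limitMean, Set.not_nonempty_iff_eq_empty.1 hk, Measure.restrict_empty, average_zero_measure]

variable [IsProbabilityMeasure P] {S : Set (Vec d)} {C : ClusteringRule d n₀ K}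

/-- Weights and means of the clusters converge to those of the final supports. -/
structure ClusterLimits (P : Measure (Vec d)) (C : ClusteringRule d n₀ K) (ω : ℕ → Vec d)
    (τ : ℕ) : Prop where
  admissible : AdmissiblePartition P (C.suppAt ω τ)
  card_eq_zero : ∀ t ≥ τ, ∀ k, ¬ (C.suppAt ω τ k).Nonempty → clusterCard (C.labelAt ω t) k = 0
  card : ∀ k, Tendsto (fun t => (clusterCard (C.labelAt ω t) k : ℝ) / (n₀ + t : ℕ)) atTop
    (𝓝 (P.real (C.suppAt ω τ k)))
  mean : ∀ k, Tendsto (fun t => clusterMean (dataset (n₀ + t) ω) (C.labelAt ω t) k) atTop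
    (𝓝 (limitMean P (C.suppAt ω τ) k))

lemma SupportRequirements.ae_clusterLimits (hn₀ : 0 < n₀) (hC : SupportRequirements P S C)
    (hS : ∀ᵐ u ∂P, u ∈ S) (hP : Integrable (fun u : Vec d => u) P) :
    ∀ᵐ ω ∂(streamLaw P), ∀ τ, DataStable C ω τ → ClusterLimits P C ω τ := by
  filter_upwards [hC.ae_tendsto_clusterAvg hS hP lipschitzFamily_const_one,
    hC.ae_tendsto_clusterAvg hS hP (lipschitzFamily_id hP), hC.ae_labelsMatch hS,
    hC.ae_admissible hS] with ω h1 h2 hl hadm τ hst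
  have hcard : ∀ k, Tendsto (fun t => (clusterCard (C.labelAt ω t) k : ℝ) / (n₀ + t : ℕ)) atTop
      (𝓝 (P.real (C.suppAt ω τ k))) := fun k => by
    have := h1 τ hst id tendsto_id k (fun _ => 0) 0 tendsto_const_nhds
    simpa [clusterAvg_one, measureReal_def] using this
  have hzero : ∀ t ≥ τ, ∀ k, ¬ (C.suppAt ω τ k).Nonempty →
      clusterCard (C.labelAt ω t) k = 0 := fun t ht k hk => by
    rw [clusterCard, Finset.card_eq_zero, Finset.filter_eq_empty_iff]
    rintro i - rfl
    exact hk ⟨_, (hl τ hst).mem t ht i⟩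
  refine ⟨hadm τ, hzero, hcard, fun k => ?_⟩
  by_cases hk : (C.suppAt ω τ k).Nonempty
  · have hpos : P.real (C.suppAt ω τ k) ≠ 0 :=
      (measureReal_ne_zero_iff (by finiteness)).2 ((hadm τ).pos k hk).ne'
    have := ((hcard k).inv₀ hpos).smul (h2 τ hst id tendsto_id k (fun _ => 0) 0 tendsto_const_nhds)
    rw [limitMean, setAverage_eq]
    refine this.congr fun t => ?_
    rw [clusterMean_eq (by omega)]
    rfl
  -- For an empty slot both means take the default value 0.
  · rw [AdmissiblePartition.limitMean_eq_zero hk]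
    refine tendsto_const_nhds.congr' ?_
    filter_upwards [eventually_ge_atTop τ] with t ht
    rw [clusterMean, hzero t ht k hk]
    simp

lemma SupportRequirements.ae_tendsto_clusterValue (hn₀ : 0 < n₀) (hC : SupportRequirements P S C)
    (hS : ∀ᵐ u ∂P, u ∈ S) (hP : MemLp (fun u : Vec d => u) 2 P) {p : ℝ} (hp : p = 1 ∨ p = 2) :
    ∀ᵐ ω ∂(streamLaw P), ∀ τ, DataStable C ω τ →
      Tendsto (fun t => clusterValue p (dataset (n₀ + t) ω) (C.labelAt ω t)) atTop
        (𝓝 (limitValue p P (C.suppAt ω τ))) := by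
  have hp0 : 0 ≤ p := by rcases hp with rfl | rfl <;> norm_num
  have hG := lipschitzFamily_norm_sub_rpow hP hp
  have hP1 := hP.integrable one_le_two
  filter_upwards [hC.ae_tendsto_clusterAvg hS hP1 hG, hC.ae_clusterLimits hn₀ hS hP1]
    with ω h1 h2 τ hst
  rw [limitValue_eq hp0 (h2 τ hst).admissible.measurable hG.integrable]
  simp only [fun t => clusterValue_eq (by omega : 0 < n₀ + t) hp0 ω (C.labelAt ω t)]
  refine ((ENNReal.continuous_rpow_const.comp ENNReal.continuous_ofReal).tendsto _).comp ?_
  exact tendsto_finsetSum _ fun k _ => h1 τ hst id tendsto_id k _ _ ((h2 τ hst).mean k)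

end Limits

/-! ### Optimal quantization -/

section Quantization

variable {d K n₀ : ℕ} {P : Measure (Vec d)}

lemma lintegral_empirical (n : ℕ) (ω : ℕ → Vec d) {g : Vec d → ℝ≥0∞} (hg : Measurable g) :
    ∫⁻ u, g u ∂(empirical (dataset n ω)) = (n : ℝ≥0∞)⁻¹ * ∑ i : Fin n, g (ω i) := by
  rw [empirical, lintegral_smul_measure, lintegral_finsetSum_measure, smul_eq_mul]
  congr 1
  exact Finset.sum_congr rfl fun i _ => lintegral_dirac' _ hg

/-- The limit means are admissible centres, and the nearest one is no farther than that of the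
cluster containing the point. -/
lemma quantError_le_limitValue {T : Fin K → Set (Vec d)} (hT : AdmissiblePartition P T) (p : ℝ)
    (hp : 0 ≤ p) : quantError K p P ≤ limitValue p P T := by
  classical
  refine ENNReal.rpow_le_rpow (iInf₂_le_of_le (Finset.univ.image (limitMean P T))
    (Finset.card_image_le.trans (by simp)) (lintegral_mono_ae ?_)) (by positivity)
  filter_upwards [hT.cover] with u hu
  obtain ⟨k, hk⟩ := hu
  refine (iInf₂_le (limitMean P T k) (Finset.mem_image_of_mem _ (Finset.mem_univ k))).trans ?_
  refine le_trans ?_ (Finset.single_le_sum (fun _ _ => zero_le) (Finset.mem_univ k))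
  simp [hk]

variable [IsProbabilityMeasure P] {S : Set (Vec d)} {C : ClusteringRule d n₀ K}

/-- The error of a fixed set of centres bounds that of the final supports, if the clusterings of
the data are optimal. -/
lemma ae_limitValue_le_of_quantError_eq (hn₀ : 0 < n₀) (hC : SupportRequirements P S C)
    (hS : ∀ᵐ u ∂P, u ∈ S) (hP : MemLp (fun u : Vec d => u) 2 P)
    (hopt : ∀ᵐ ω ∂(streamLaw P), ∀ t, clusterValue 2 (dataset (n₀ + t) ω) (C.labelAt ω t)
      = quantError K 2 (empirical (dataset (n₀ + t) ω)))
    (A : Finset (Vec d)) (hA : A.card ≤ K) :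
    ∀ᵐ ω ∂(streamLaw P), ∀ τ, DataStable C ω τ → limitValue 2 P (C.suppAt ω τ)
      ≤ (∫⁻ u, ⨅ a ∈ A, ‖u - a‖ₑ ^ (2 : ℝ) ∂P) ^ (1 / (2 : ℝ)) := by
  -- Without centres the error is infinite. Otherwise the squared distance to `a₀` is an integrable
  -- bound, as the strong law requires.
  rcases A.eq_empty_or_nonempty with rfl | ⟨a₀, ha₀⟩
  · refine Eventually.of_forall fun ω τ _ => ?_
    simp
  set g : Vec d → ℝ≥0∞ := fun u => ⨅ a ∈ A, ‖u - a‖ₑ ^ (2 : ℝ) with hg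
  have hgm : Measurable g := Measurable.biInf _ A.countable_toSet fun a _ => by fun_prop
  have hle : ∀ u, g u ≤ ENNReal.ofReal (‖u - a₀‖ ^ (2 : ℝ)) := fun u => by
    rw [ofReal_norm_rpow zero_le_two]
    exact iInf₂_le a₀ ha₀
  have htop : ∀ u, g u ≠ ⊤ := fun u => ne_top_of_le_ne_top ENNReal.ofReal_ne_top (hle u)
  have hint : Integrable (fun u => (g u).toReal) P := by
    refine ((lipschitzFamily_norm_sub_rpow hP (.inr rfl)).integrable a₀).mono'
      hgm.ennreal_toReal.aestronglyMeasurable (Eventually.of_forall fun u => ?_)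
    rw [Real.norm_of_nonneg ENNReal.toReal_nonneg]
    exact ENNReal.toReal_le_of_le_ofReal (by positivity) (hle u)
  have hlint : ∫⁻ u, g u ∂P = ENNReal.ofReal (∫ u, (g u).toReal ∂P) := by
    rw [ofReal_integral_eq_lintegral_ofReal hint
      (Eventually.of_forall fun _ => ENNReal.toReal_nonneg)]
    simp only [ENNReal.ofReal_toReal (htop _)]
  filter_upwards [ae_tendsto_runningMean P hgm.ennreal_toReal hint, hopt,
    hC.ae_tendsto_clusterValue hn₀ hS hP (.inr rfl)] with ω h1 h2 h3 τ hst
  rw [hlint]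
  have h4 : Tendsto (fun t : ℕ => (ENNReal.ofReal (runningMean (fun i => (g (ω i)).toReal)
      (n₀ + t))) ^ (1 / (2 : ℝ))) atTop
      (𝓝 ((ENNReal.ofReal (∫ u, (g u).toReal ∂P)) ^ (1 / (2 : ℝ)))) :=
    ((ENNReal.continuous_rpow_const.comp ENNReal.continuous_ofReal).tendsto _).comp
      (h1.comp (tendsto_atTop_mono (fun t => Nat.le_add_left t n₀) tendsto_id))
  refine le_of_tendsto_of_tendsto' (h3 τ hst) h4 fun t => ?_
  rw [h2 t]
  refine ENNReal.rpow_le_rpow ((iInf₂_le A hA).trans_eq ?_) (by norm_num)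
  rw [lintegral_empirical _ _ hgm, runningMean, smul_eq_mul, ENNReal.ofReal_mul (by positivity),
    ENNReal.ofReal_inv_of_pos (by positivity), ENNReal.ofReal_natCast, Finset.sum_range,
    ENNReal.ofReal_sum_of_nonneg fun _ _ => ENNReal.toReal_nonneg]
  simp only [ENNReal.ofReal_toReal (htop _)]

/-- A minimizing sequence of centre sets keeps the exceptional null sets countable; convergence of
optimal centres is not needed. -/
lemma ae_limitValue_eq_quantError (hn₀ : 0 < n₀) (hC : SupportRequirements P S C)
    (hS : ∀ᵐ u ∂P, u ∈ S) (hP : MemLp (fun u : Vec d => u) 2 P)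
    (hopt : ∀ᵐ ω ∂(streamLaw P), ∀ t, clusterValue 2 (dataset (n₀ + t) ω) (C.labelAt ω t)
      = quantError K 2 (empirical (dataset (n₀ + t) ω))) :
    ∀ᵐ ω ∂(streamLaw P), ∀ τ, DataStable C ω τ →
      limitValue 2 P (C.suppAt ω τ) = quantError K 2 P := by
  obtain ⟨c, -, hc, hmem⟩ := exists_seq_tendsto_sInf
    (S := {c : ℝ≥0∞ | ∃ A : Finset (Vec d), A.card ≤ K ∧
      ∫⁻ u, ⨅ a ∈ A, ‖u - a‖ₑ ^ (2 : ℝ) ∂P = c}) ⟨_, ∅, by simp, rfl⟩ (OrderBot.bddBelow _)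
  choose A hA hAc using hmem
  filter_upwards [ae_all_iff.2 fun n =>
    ae_limitValue_le_of_quantError_eq hn₀ hC hS hP hopt (A n) (hA n),
    hC.ae_admissible hS] with ω h1 h2 τ hst
  refine le_antisymm ?_ (quantError_le_limitValue (h2 τ) 2 zero_le_two)
  have hq : quantError K 2 P = (sInf {c : ℝ≥0∞ | ∃ A : Finset (Vec d), A.card ≤ K ∧
      ∫⁻ u, ⨅ a ∈ A, ‖u - a‖ₑ ^ (2 : ℝ) ∂P = c}) ^ (1 / (2 : ℝ)) := by
    rw [quantError]
    congr 1
    refine le_antisymm (le_sInf ?_) (le_iInf₂ fun A hA => sInf_le ⟨A, hA, rfl⟩)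
    rintro _ ⟨A, hA, rfl⟩
    exact iInf₂_le A hA
  rw [hq]
  refine ge_of_tendsto' ((ENNReal.continuous_rpow_const.tendsto _).comp hc) fun n => ?_
  simpa only [Function.comp, ← hAc n] using h1 n τ hst

end Quantization


/-! ### Couplings between data and clusters -/

section Coupling

variable {d K n₀ : ℕ}

/-- A matrix of weights with the right marginals bounds the distance between the data and their
clusters. -/
lemma clusterWass_one_le {n : ℕ} (hn : 0 < n) (D : Fin n → Vec d) (l : Fin n → Fin K)
    {W : Fin n → Fin K → ℝ} (h0 : ∀ i k, 0 ≤ W i k) (h1 : ∀ i, ∑ k, W i k = 1)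
    (h2 : ∀ k, ∑ i, W i k = clusterCard l k) :
    clusterWass 1 D l
      ≤ ENNReal.ofReal ((n : ℝ)⁻¹ * ∑ k, ∑ i, W i k * ‖D i - clusterMean D l k‖) := by
  have hn' : (0 : ℝ) < n := by exact_mod_cast hn
  rw [clusterWass, wasserstein, div_one, ENNReal.rpow_one]
  refine (iInf₂_le (∑ k, ∑ i, ENNReal.ofReal ((n : ℝ)⁻¹ * W i k) •
    Measure.dirac (D i, clusterMean D l k)) ⟨?_, ?_⟩).trans_eq ?_
  · rw [lintegral_finsetSum_measure, Finset.mul_sum, ENNReal.ofReal_sum_of_nonneg fun k _ =>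
      mul_nonneg (by positivity) (Finset.sum_nonneg fun i _ => mul_nonneg (h0 i k) (norm_nonneg _))]
    refine Finset.sum_congr rfl fun k _ => ?_
    rw [lintegral_finsetSum_measure, Finset.mul_sum, ENNReal.ofReal_sum_of_nonneg fun i _ =>
      mul_nonneg (by positivity) (mul_nonneg (h0 i k) (norm_nonneg _))]
    refine Finset.sum_congr rfl fun i _ => ?_
    rw [lintegral_smul_measure, lintegral_dirac' _ (by fun_prop), ENNReal.rpow_one, smul_eq_mul,
      ← mul_assoc, ENNReal.ofReal_mul (mul_nonneg (by positivity) (h0 i k)), ofReal_norm]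
  · ext s hs
    rw [Measure.map_apply measurable_fst hs]
    simp only [Measure.coe_finsetSum, Finset.sum_apply, Measure.smul_apply, smul_eq_mul, empirical,
      Measure.dirac_apply' _ hs, Measure.dirac_apply' _ (measurable_fst hs)]
    rw [Finset.sum_comm, Finset.mul_sum]
    refine Finset.sum_congr rfl fun i _ => ?_
    have : ∀ k, (Prod.fst ⁻¹' s).indicator (1 : Vec d × Vec d → ℝ≥0∞) (D i, clusterMean D l k)
        = s.indicator 1 (D i) := fun k => rfl
    simp only [this]
    rw [← Finset.sum_mul, ← ENNReal.ofReal_sum_of_nonneg fun k _ => mul_nonneg (by positivity)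
      (h0 i k), ← Finset.mul_sum, h1, mul_one, ENNReal.ofReal_inv_of_pos hn', ENNReal.ofReal_natCast]
  · ext s hs
    rw [Measure.map_apply measurable_snd hs]
    simp only [Measure.coe_finsetSum, Finset.sum_apply, Measure.smul_apply, smul_eq_mul, clustered,
      Measure.dirac_apply' _ hs, Measure.dirac_apply' _ (measurable_snd hs)]
    refine Finset.sum_congr rfl fun k _ => ?_
    have : ∀ i, (Prod.snd ⁻¹' s).indicator (1 : Vec d × Vec d → ℝ≥0∞) (D i, clusterMean D l k)
        = s.indicator 1 (clusterMean D l k) := fun i => rfl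
    simp only [this]
    rw [← Finset.sum_mul, ← ENNReal.ofReal_sum_of_nonneg fun i _ => mul_nonneg (by positivity)
      (h0 i k), ← Finset.mul_sum, h2, ENNReal.ofReal_mul (by positivity),
      ENNReal.ofReal_inv_of_pos hn', ENNReal.ofReal_natCast, ENNReal.ofReal_natCast,
      ENNReal.div_eq_inv_mul]

/-- With weights in `[0, 1]`, moving the centre changes the average by at most the displacement,
whatever the number of terms. -/
lemma tendsto_runningMean_mul_norm_sub {b : ℕ → ℝ} (hb : ∀ i, 0 ≤ b i ∧ b i ≤ 1) {ω : ℕ → Vec d}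
    {m : Vec d} {c : ℝ} (h : Tendsto (runningMean fun i => b i * ‖ω i - m‖) atTop (𝓝 c))
    {N : ℕ → ℕ} (hN : Tendsto N atTop atTop) {m' : ℕ → Vec d} (hm : Tendsto m' atTop (𝓝 m)) :
    Tendsto (fun t => runningMean (fun i => b i * ‖ω i - m' t‖) (N t)) atTop (𝓝 c) := by
  have h0 : Tendsto (fun t => runningMean (fun i => b i * ‖ω i - m' t‖) (N t)
      - runningMean (fun i => b i * ‖ω i - m‖) (N t)) atTop (𝓝 0) := by
    refine squeeze_zero_norm (fun t => ?_) (tendsto_iff_norm_sub_tendsto_zero.1 hm)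
    rw [runningMean, runningMean, ← smul_sub, ← Finset.sum_sub_distrib, norm_smul, norm_inv,
      Real.norm_natCast]
    have h1 : ‖∑ i ∈ Finset.range (N t), (b i * ‖ω i - m' t‖ - b i * ‖ω i - m‖)‖
        ≤ N t * ‖m' t - m‖ := by
      refine (norm_sum_le_of_le (f := fun i => b i * ‖ω i - m' t‖ - b i * ‖ω i - m‖) _
        fun i _ => ?_).trans_eq (by rw [Finset.sum_const, Finset.card_range, nsmul_eq_mul])
      rw [← mul_sub, norm_mul, Real.norm_of_nonneg (hb i).1]
      refine (mul_le_of_le_one_left (norm_nonneg _) (hb i).2).trans ?_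
      refine (abs_norm_sub_norm_le _ _).trans_eq ?_
      rw [sub_sub_sub_cancel_left, norm_sub_rev]
    rcases (N t).eq_zero_or_pos with h2 | h2
    · simp [h2]
    · rw [inv_mul_le_iff₀ (by positivity)]
      exact h1
  simpa using h0.add (h.comp hN)

lemma sum_clusterCard {n : ℕ} (l : Fin n → Fin K) : ∑ k, (clusterCard l k : ℝ) = n := by
  have := Finset.card_eq_sum_card_fiberwise (s := Finset.univ) (t := Finset.univ) (f := l)
    (fun _ _ => Finset.mem_coe.2 (Finset.mem_univ _))
  rw [Finset.card_univ, Fintype.card_fin] at this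
  conv_rhs => rw [this]
  push_cast
  rfl

variable {P : Measure (Vec d)} {C : ClusteringRule d n₀ K}

/-- If the clusterings of the data are optimal couplings, then fractional assignments of the data
to the clusters with the right asymptotic weights cannot be better than the final supports. -/
lemma ClusterLimits.limitValue_one_le (hn₀ : 0 < n₀) {ω : ℕ → Vec d} {τ : ℕ}
    (h : ClusterLimits P C ω τ)
    (hval : Tendsto (fun t => clusterValue 1 (dataset (n₀ + t) ω) (C.labelAt ω t)) atTop
        (𝓝 (limitValue 1 P (C.suppAt ω τ))))
    (hopt : ∀ t, clusterValue 1 (dataset (n₀ + t) ω) (C.labelAt ω t)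
      = clusterWass 1 (dataset (n₀ + t) ω) (C.labelAt ω t)) [IsFiniteMeasure P]
    {v : Fin K → ℕ → ℝ} {c e : Fin K → ℝ} (h0 : ∀ k i, 0 ≤ v k i) (h1 : ∀ i, ∑ k, v k i = 1)
    (hempty : ∀ k, ¬ (C.suppAt ω τ k).Nonempty → ∀ i, v k i = 0)
    (hv : ∀ k, Tendsto (runningMean (v k)) atTop (𝓝 (P.real (C.suppAt ω τ k))))
    (hc : ∀ k, Tendsto (runningMean fun i => v k i * ‖ω i - limitMean P (C.suppAt ω τ) k‖) atTop
      (𝓝 (c k)))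
    (he : ∀ k, Tendsto (runningMean fun i => ‖ω i - limitMean P (C.suppAt ω τ) k‖) atTop
      (𝓝 (e k))) :
    limitValue 1 P (C.suppAt ω τ) ≤ ENNReal.ofReal (∑ k, c k) := by
  have hN : Tendsto (fun t => n₀ + t) atTop atTop :=
    tendsto_atTop_mono (fun t => Nat.le_add_left t n₀) tendsto_id
  have hv1 : ∀ k i, v k i ≤ 1 := fun k i => by
    rw [← h1 i]
    exact Finset.single_le_sum (f := fun k => v k i) (fun k _ => h0 k i) (Finset.mem_univ k)
  set T := C.suppAt ω τ with hT
  -- The column sums of `v` match the cluster sizes only asymptotically. Shrinking `v` by `1 - δ`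
  -- leaves room for a nonnegative correction, the same for all points, that makes them exact; its
  -- cost vanishes with `δ`.
  have key : ∀ δ : ℝ, 0 < δ → δ < 1 → limitValue 1 P T
      ≤ ENNReal.ofReal (∑ k, ((1 - δ) * c k + (P.real (T k) - (1 - δ) * P.real (T k)) * e k)) := by
    intro δ hδ hδ1
    have hlim : Tendsto (fun t => ∑ k, ((1 - δ) * runningMean (fun i => v k i * ‖ω i -
          clusterMean (dataset (n₀ + t) ω) (C.labelAt ω t) k‖) (n₀ + t)
        + ((clusterCard (C.labelAt ω t) k : ℝ) / (n₀ + t : ℕ)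
            - (1 - δ) * runningMean (v k) (n₀ + t))
          * runningMean (fun i => 1 * ‖ω i -
            clusterMean (dataset (n₀ + t) ω) (C.labelAt ω t) k‖) (n₀ + t))) atTop
        (𝓝 (∑ k, ((1 - δ) * c k + (P.real (T k) - (1 - δ) * P.real (T k)) * e k))) := by
      refine tendsto_finsetSum _ fun k _ => Tendsto.add (Tendsto.const_mul _ ?_)
        (Tendsto.mul ((h.card k).sub (((hv k).comp hN).const_mul _)) ?_)
      · exact tendsto_runningMean_mul_norm_sub (fun i => ⟨h0 k i, hv1 k i⟩) (hc k) hN (h.mean k)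
      · refine tendsto_runningMean_mul_norm_sub (fun i => ⟨zero_le_one, le_rfl⟩) ?_ hN (h.mean k)
        simpa using he k
    have hnonneg : ∀ k, ∀ᶠ t in atTop, (1 - δ) * runningMean (v k) (n₀ + t)
        ≤ (clusterCard (C.labelAt ω t) k : ℝ) / (n₀ + t : ℕ) := by
      intro k
      -- Both weights tend to the same limit; if it is positive, the factor `1 - δ` separates them
      -- eventually. For an empty slot the left side is 0.
      by_cases hk : (T k).Nonempty
      · have hpos : 0 < P.real (T k) :=
          ENNReal.toReal_pos (h.admissible.pos k hk).ne' (by finiteness)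
        have := (((hv k).comp hN).const_mul (1 - δ)).eventually_lt (h.card k)
          (by nlinarith)
        exact this.mono fun t ht => ht.le
      · refine Eventually.of_forall fun t => ?_
        simp only [runningMean, hempty k hk]
        simp only [Finset.sum_const_zero, smul_zero, mul_zero]
        positivity
    refine le_of_tendsto_of_tendsto hval ((ENNReal.continuous_ofReal.tendsto _).comp hlim) ?_
    filter_upwards [eventually_all.2 hnonneg] with t ht
    have hn : 0 < n₀ + t := by omega
    have hn' : ((n₀ + t : ℕ) : ℝ) ≠ 0 := by positivity
    rw [hopt t]
    refine (clusterWass_one_le hn _ _ (W := fun i k => (1 - δ) * v k i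
      + ((clusterCard (C.labelAt ω t) k : ℝ) / (n₀ + t : ℕ)
        - (1 - δ) * runningMean (v k) (n₀ + t))) ?_ ?_ ?_).trans_eq ?_
    · intro i k
      have := ht k
      have := mul_nonneg (by linarith : 0 ≤ 1 - δ) (h0 k i)
      linarith
    · intro i
      have hs : ∑ k, runningMean (v k) (n₀ + t) = 1 := by
        simp only [runningMean, smul_eq_mul]
        rw [← Finset.mul_sum, Finset.sum_comm]
        simp only [h1, Finset.sum_const, Finset.card_range, nsmul_eq_mul, mul_one]
        exact inv_mul_cancel₀ hn'
      rw [Finset.sum_add_distrib, Finset.sum_sub_distrib, ← Finset.mul_sum, ← Finset.mul_sum, h1,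
        hs, ← Finset.sum_div, sum_clusterCard, div_self hn']
      ring
    · intro k
      rw [Finset.sum_add_distrib, Finset.sum_const, ← Finset.mul_sum, Finset.card_univ,
        Fintype.card_fin, nsmul_eq_mul, mul_sub, mul_div_cancel₀ _ hn', runningMean,
        ← Finset.sum_range, smul_eq_mul]
      field_simp
      ring
    · simp only [Function.comp]
      congr 1
      rw [Finset.mul_sum]
      refine Finset.sum_congr rfl fun k _ => ?_
      simp only [add_mul, Finset.sum_add_distrib, runningMean, smul_eq_mul, one_mul,
        Finset.sum_range, mul_add, mul_assoc, ← Finset.mul_sum]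
      have : ∀ i, dataset (n₀ + t) ω i = ω i := fun i => rfl
      simp only [this]
      ring
  have hcont : Tendsto (fun δ : ℝ => ENNReal.ofReal
      (∑ k, ((1 - δ) * c k + (P.real (T k) - (1 - δ) * P.real (T k)) * e k))) (𝓝[>] 0)
      (𝓝 (ENNReal.ofReal (∑ k, c k))) := by
    have : Continuous fun δ : ℝ => ENNReal.ofReal
      (∑ k, ((1 - δ) * c k + (P.real (T k) - (1 - δ) * P.real (T k)) * e k)) :=
      ENNReal.continuous_ofReal.comp (by fun_prop)
    have h2 := (this.tendsto 0).mono_left (nhdsWithin_le_nhds (s := Set.Ioi 0))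
    simpa using h2
  refine ge_of_tendsto hcont ?_
  filter_upwards [Ioo_mem_nhdsGT (zero_lt_one' ℝ)] with δ hδ using key δ hδ.1 hδ.2

end Coupling

/-! ### The distance to the limit distribution -/

section LimitDistance

variable {d K n₀ : ℕ} {P : Measure (Vec d)}

open Classical in
/-- The share of the atom at `v` of the limit distribution that is due to cluster `k`. -/
def atomShare (P : Measure (Vec d)) (T : Fin K → Set (Vec d)) (k : Fin K) (v : Vec d) : ℝ :=
  if v = limitMean P T k then P.real (T k) / (limitDist P T).real {limitMean P T k} else 0

variable {T : Fin K → Set (Vec d)}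

lemma atomShare_nonneg (k : Fin K) (v : Vec d) : 0 ≤ atomShare P T k v := by
  rw [atomShare]; split_ifs <;> positivity

lemma measurable_atomShare (k : Fin K) : Measurable (atomShare P T k) :=
  Measurable.ite (measurableSet_singleton _) measurable_const measurable_const

lemma ae_limitDist_of_forall {p : Vec d → Prop} (hp : MeasurableSet {v | p v})
    (h : ∀ k, P (T k) ≠ 0 → p (limitMean P T k)) : ∀ᵐ v ∂(limitDist P T), p v := by
  change limitDist P T {v | p v}ᶜ = 0
  simp only [limitDist, Measure.coe_finsetSum, Finset.sum_apply, Measure.smul_apply, smul_eq_mul,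
    Measure.dirac_apply' _ hp.compl]
  refine Finset.sum_eq_zero fun k _ => ?_
  by_cases hk : P (T k) = 0
  · simp [hk]
  · have := h k hk
    simp [this]

variable [IsProbabilityMeasure P]

instance : IsFiniteMeasure (limitDist P T) := by
  refine ⟨?_⟩
  simp only [limitDist, Measure.coe_finsetSum, Finset.sum_apply, Measure.smul_apply, smul_eq_mul]
  exact ENNReal.sum_lt_top.2 fun k _ => by
    rw [measure_univ, mul_one]; exact measure_lt_top _ _

lemma limitDist_real_singleton (v : Vec d) :
    (limitDist P T).real {v} = ∑ k, if v = limitMean P T k then P.real (T k) else 0 := by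
  rw [measureReal_def, limitDist]
  simp only [Measure.coe_finsetSum, Finset.sum_apply, Measure.smul_apply, smul_eq_mul,
    Measure.dirac_apply' _ (measurableSet_singleton v)]
  rw [ENNReal.toReal_sum fun k _ => ENNReal.mul_ne_top (by finiteness) (by
    simp only [Set.indicator]; split_ifs <;> simp)]
  refine Finset.sum_congr rfl fun k _ => ?_
  by_cases h : v = limitMean P T k
  · simp [h, measureReal_def]
  · simp [h, Ne.symm h]

lemma le_limitDist_real (k : Fin K) : P.real (T k) ≤ (limitDist P T).real {limitMean P T k} := by
  rw [limitDist_real_singleton]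
  refine le_trans (by simp) (Finset.single_le_sum (f := fun k' =>
    if limitMean P T k = limitMean P T k' then P.real (T k') else 0)
    (fun k' _ => by split_ifs <;> positivity) (Finset.mem_univ k))

lemma atomShare_le_one (k : Fin K) (v : Vec d) : atomShare P T k v ≤ 1 := by
  rw [atomShare]
  split_ifs
  · exact div_le_one_of_le₀ (le_limitDist_real k) measureReal_nonneg
  · exact zero_le_one

lemma integral_atomShare (k : Fin K) : ∫ v, atomShare P T k v ∂(limitDist P T) = P.real (T k) := by
  have : atomShare P T k = ({limitMean P T k} : Set (Vec d)).indicator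
      fun _ => P.real (T k) / (limitDist P T).real {limitMean P T k} := by
    ext v
    by_cases h : v = limitMean P T k <;> simp [atomShare, h]
  rw [this, integral_indicator (measurableSet_singleton _), setIntegral_const, smul_eq_mul]
  -- A massless atom makes the quotient 0 by convention, which is correct since the cluster is then
  -- null too.
  by_cases h : (limitDist P T).real {limitMean P T k} = 0
  · have := le_limitDist_real (P := P) (T := T) k
    rw [h, zero_mul]
    exact le_antisymm measureReal_nonneg (h ▸ this)
  · exact mul_div_cancel₀ _ h

/-- Several clusters may have the same mean; their shares then have a common denominator, the mass
of the atom. -/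
lemma ae_sum_atomShare : ∀ᵐ v ∂(limitDist P T), ∑ k, atomShare P T k v = 1 := by
  refine ae_limitDist_of_forall (measurableSet_eq_fun
    (Finset.measurable_sum _ fun k _ => measurable_atomShare k) measurable_const) fun k hk => ?_
  have hpos : 0 < (limitDist P T).real {limitMean P T k} :=
    (ENNReal.toReal_pos hk (by finiteness)).trans_le (le_limitDist_real k)
  have : ∀ k', atomShare P T k' (limitMean P T k) =
      (if limitMean P T k = limitMean P T k' then P.real (T k') else 0)
        / (limitDist P T).real {limitMean P T k} := fun k' => by
    by_cases h : limitMean P T k = limitMean P T k'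
    · rw [atomShare, if_pos h, if_pos h, h]
    · rw [atomShare, if_neg h, if_neg h, zero_div]
  simp only [this]
  rw [← Finset.sum_div, ← limitDist_real_singleton, div_self hpos.ne']

variable {S : Set (Vec d)} {C : ClusteringRule d n₀ K}

lemma measurableSet_dataStable (hC : SupportRequirements P S C) (τ : ℕ) :
    MeasurableSet {ω | DataStable C ω τ} := by
  have h : ∀ t k i, MeasurableSet {ω : ℕ → Vec d | ω i ∈ C.suppAt ω t k} := fun t k i =>
    ((measurable_dataset (n₀ + t)).prodMk (measurable_pi_apply i)) (hC.measurable t k)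
  simp only [DataStable, Set.ofPred_forall]
  exact MeasurableSet.iInter fun t => MeasurableSet.iInter fun _ => MeasurableSet.iInter fun k =>
    MeasurableSet.iInter fun i => MeasurableSet.iInter fun _ => (h t k i).iff (h τ k i)

lemma suppAt_splice (ω ω' : ℕ → Vec d) (τ : ℕ) :
    C.suppAt (splice (n₀ + τ) ω ω') τ = C.suppAt ω τ := by
  rw [ClusteringRule.suppAt, dataset_splice]; rfl

/-- A share vanishes unless `w.2` is the mean of its cluster, so the weighted distances to the means
add up to `‖w.1 - w.2‖`. -/
lemma integral_coupling_eq {π : Measure (Vec d × Vec d)} (h1 : π.map Prod.fst = P)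
    (h2 : π.map Prod.snd = limitDist P T) (hP : Integrable (fun u : Vec d => u) P) :
    (∀ k, Integrable (fun w : Vec d × Vec d => ‖w.1 - limitMean P T k‖) π) ∧
    (∀ k, Integrable (fun w : Vec d × Vec d =>
      atomShare P T k w.2 * ‖w.1 - limitMean P T k‖) π) ∧
    ENNReal.ofReal (∑ k, ∫ w, atomShare P T k w.2 * ‖w.1 - limitMean P T k‖ ∂π)
      = ∫⁻ w, ‖w.1 - w.2‖ₑ ^ (1 : ℝ) ∂π := by
  have hi1 : ∀ k, Integrable (fun w : Vec d × Vec d => ‖w.1 - limitMean P T k‖) π := fun k => by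
    have hint : Integrable (fun u => ‖u - limitMean P T k‖) (π.map Prod.fst) := by
      rw [h1]
      exact (hP.sub (integrable_const _)).norm
    exact hint.comp_measurable measurable_fst
  have hi2 : ∀ k, Integrable (fun w : Vec d × Vec d =>
      atomShare P T k w.2 * ‖w.1 - limitMean P T k‖) π := fun k => by
    refine (hi1 k).mono' (((measurable_atomShare k).comp measurable_snd).mul
      (by fun_prop)).aestronglyMeasurable (Eventually.of_forall fun w => ?_)
    rw [norm_mul, norm_norm, Real.norm_of_nonneg (atomShare_nonneg k _)]
    exact mul_le_of_le_one_left (norm_nonneg _) (atomShare_le_one k _)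
  refine ⟨hi1, hi2, ?_⟩
  rw [← integral_finsetSum _ fun k _ => hi2 k, ofReal_integral_eq_lintegral_ofReal
    (integrable_finsetSum _ fun k _ => hi2 k) (Eventually.of_forall fun w => Finset.sum_nonneg
      fun k _ => mul_nonneg (atomShare_nonneg k _) (norm_nonneg _))]
  have hs := ae_sum_atomShare (P := P) (T := T)
  rw [← h2] at hs
  refine lintegral_congr_ae ?_
  filter_upwards [ae_of_ae_map measurable_snd.aemeasurable hs] with w hw
  rw [ENNReal.rpow_one, ← ofReal_norm]
  congr 1
  rw [← one_mul ‖w.1 - w.2‖, ← hw, Finset.sum_mul]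
  refine Finset.sum_congr rfl fun k _ => ?_
  by_cases h : w.2 = limitMean P T k
  · rw [h]
  · simp [atomShare, h]

/-- There are uncountably many couplings, each with its own null set. But the inequality for one
coupling involves only the prefix of `ω`. It is therefore enough to find, for each coupling, one
continuation of that prefix along which the limits hold, and continuations that keep the data stable
have positive probability. -/
lemma ae_limitValue_le_limitWass (hn₀ : 0 < n₀) (hC : SupportRequirements P S C)
    (hS : ∀ᵐ u ∂P, u ∈ S) (hP : MemLp (fun u : Vec d => u) 2 P)
    (hopt : ∀ᵐ ω ∂(streamLaw P), ∀ t, clusterValue 1 (dataset (n₀ + t) ω) (C.labelAt ω t)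
      = clusterWass 1 (dataset (n₀ + t) ω) (C.labelAt ω t)) :
    ∀ᵐ ω ∂(streamLaw P), ∀ τ, DataStable C ω τ →
      limitValue 1 P (C.suppAt ω τ) ≤ limitWass 1 P (C.suppAt ω τ) := by
  refine ae_all_iff.2 fun τ => ?_
  have hP1 := hP.integrable one_le_two
  filter_upwards [ae_mem_imp_splice_ne_zero P (n₀ + τ) (measurableSet_dataStable hC τ),
    ae_ae_splice P (n₀ + τ) hopt,
    ae_ae_splice P (n₀ + τ) (hC.ae_tendsto_clusterValue hn₀ hS hP (.inl rfl)),
    ae_ae_splice P (n₀ + τ) (hC.ae_clusterLimits hn₀ hS hP1)] with ω hR g1 g2 g3 hst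
  rw [limitWass, wasserstein, div_one, ENNReal.rpow_one]
  refine le_iInf₂ fun π hπ => ?_
  obtain ⟨h1, h2⟩ := hπ
  have hprob : IsProbabilityMeasure π := by
    refine ⟨?_⟩
    rw [← Set.preimage_univ (f := Prod.fst), ← Measure.map_apply measurable_fst MeasurableSet.univ,
      h1, measure_univ]
  obtain ⟨hi1, hi2, hcost⟩ := integral_coupling_eq h1 h2 hP1
  set T := C.suppAt ω τ with hT
  have hmap : MeasurePreserving (fun (ρ : ℕ → Vec d × Vec d) (i : ℕ) => (ρ i).1)
      (Measure.infinitePi fun _ : ℕ => π) (streamLaw P) := by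
    refine ⟨by fun_prop, ?_⟩
    rw [Measure.infinitePi_map_pi (fun _ : ℕ => π) (f := fun _ => Prod.fst)
      fun _ => measurable_fst]
    simp only [h1]
  -- Stability involves only first coordinates, whose law is that of the data, so it keeps its
  -- positive probability under `π`.
  have hfreq : ∃ᵐ ρ ∂(Measure.infinitePi fun _ : ℕ => π),
      DataStable C (splice (n₀ + τ) ω fun i => (ρ i).1) τ := by
    rw [frequently_ae_iff]
    have hm : MeasurableSet {ω' | splice (n₀ + τ) ω ω' ∈ {ω | DataStable C ω τ}} :=
      ((measurable_splice (n₀ + τ)).comp measurable_prodMk_left) (measurableSet_dataStable hC τ)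
    exact fun h => hR hst ((hmap.measure_preimage hm.nullMeasurableSet).symm.trans h)
  have hshare := ae_sum_atomShare (P := P) (T := T)
  rw [← h2] at hshare
  have hs : ∀ᵐ ρ ∂(Measure.infinitePi fun _ : ℕ => π), ∀ i,
      ∑ k, atomShare P T k (ρ i).2 = 1 := ae_all_iff.2 fun i =>
    (measurePreserving_eval_infinitePi (fun _ : ℕ => π) i).quasiMeasurePreserving.ae
      (ae_of_ae_map measurable_snd.aemeasurable hshare)
  have hL1 : ∀ᵐ ρ ∂(Measure.infinitePi fun _ : ℕ => π), ∀ k,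
      Tendsto (runningMean fun i => atomShare P T k (ρ i).2) atTop (𝓝 (P.real (T k))) := by
    refine ae_all_iff.2 fun k => ?_
    have hm : Measurable fun w : Vec d × Vec d => atomShare P T k w.2 :=
      (measurable_atomShare k).comp measurable_snd
    have := ae_tendsto_runningMean π hm (Integrable.of_bound hm.aestronglyMeasurable 1
      (Eventually.of_forall fun w => by
        rw [Real.norm_of_nonneg (atomShare_nonneg k _)]; exact atomShare_le_one k _))
    rwa [← integral_map (φ := Prod.snd) (f := atomShare P T k) measurable_snd.aemeasurable
      (measurable_atomShare k).aestronglyMeasurable, h2, integral_atomShare] at this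
  have hL2 := ae_all_iff.2 fun k => ae_tendsto_runningMean π
    (((measurable_atomShare k).comp measurable_snd).mul (by fun_prop)) (hi2 k)
  have hL3 := ae_all_iff.2 fun k => ae_tendsto_runningMean π (by fun_prop) (hi1 k)
  -- An event of positive probability meets the intersection of finitely many almost sure events.
  obtain ⟨ρ, hρ, hs, hL1, hL2, hL3, g1, g2, g3⟩ := (hfreq.and_eventually
    (hs.and (hL1.and (hL2.and (hL3.and ((hmap.quasiMeasurePreserving.ae g1).and
      ((hmap.quasiMeasurePreserving.ae g2).and (hmap.quasiMeasurePreserving.ae g3)))))))).exists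
  set ω' := splice (n₀ + τ) ω fun i => (ρ i).1 with hω'
  have hT' : C.suppAt ω' τ = T := suppAt_splice _ _ _
  have htail : ∀ i, n₀ + τ ≤ i → (ρ i).1 = ω' i := fun i hi => by
    simp [hω', splice, not_lt.2 hi]
  have := (g3 τ hρ).limitValue_one_le hn₀ (g2 τ hρ) g1
    (v := fun k i => atomShare P T k (ρ i).2)
    (c := fun k => ∫ w, atomShare P T k w.2 * ‖w.1 - limitMean P T k‖ ∂π)
    (e := fun k => ∫ w, ‖w.1 - limitMean P T k‖ ∂π)
    (fun k i => atomShare_nonneg _ _) hs (fun k hk i => ?_) (fun k => ?_) (fun k => ?_)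
    (fun k => ?_)
  · rwa [hT', hcost] at this
  · rw [hT', Set.not_nonempty_iff_eq_empty] at hk
    simp [atomShare, hk]
  · rw [hT']; exact hL1 k
  · rw [hT']
    exact tendsto_runningMean_congr (n₀ + τ) (fun i hi => by
      simp only [Pi.mul_apply, Function.comp, htail i hi]) (hL2 k)
  · rw [hT']
    exact tendsto_runningMean_congr (n₀ + τ) (fun i hi => by rw [htail i hi]) (hL3 k)

end LimitDistance


/-! ### Dual variables of the program for affine pieces -/

section Dual

variable {d m J K : ℕ}

lemma eq_zero_of_inner_le {w : Vec d} {α : ℝ} (h : ∀ u : Vec d, ⟪w, u⟫ ≤ α) : w = 0 := by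
  by_contra hw
  have hpos : 0 < ‖w‖ ^ 2 := by positivity
  -- The multiple of `w` whose inner product with `w` is `α + 1`.
  have := h (((α + 1) / ‖w‖ ^ 2) • w)
  rw [real_inner_smul_right, real_inner_self_eq_norm_sq, div_mul_cancel₀ _ hpos.ne'] at this
  linarith

lemma transportTerm_ne_bot (r : ℝ≥0∞) (ε lam ν : ℝ) : transportTerm r ε lam ν ≠ ⊥ := by
  unfold transportTerm
  split_ifs <;> first | exact EReal.coe_ne_bot _ | exact EReal.zero_ne_bot | exact top_ne_bot

/-- In `EReal` an infinite term could be cancelled by `⊥`, hence the four side conditions. -/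
lemma ne_top_of_add_le_coe {a b c e : EReal} {s : ℝ} (ha : a ≠ ⊥) (hb : b ≠ ⊥)
    (hc : c ≠ ⊥) (he : e ≠ ⊥) (h : a + b + c + e ≤ (s : EReal)) : a ≠ ⊤ ∧ b ≠ ⊤ := by
  have hs : a + b + c + e ≠ ⊤ := (h.trans_lt (EReal.coe_lt_top s)).ne
  constructor
  · rintro rfl
    rw [EReal.top_add_of_ne_bot hb, EReal.top_add_of_ne_bot hc, EReal.top_add_of_ne_bot he] at hs
    exact hs rfl
  · rintro rfl
    rw [EReal.add_top_of_ne_bot ha, EReal.top_add_of_ne_bot hc, EReal.top_add_of_ne_bot he] at hs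
    exact hs rfl

lemma eq_zero_of_supportFun_univ {y : Vec d} (h : supportFun Set.univ y ≠ ⊤) : y = 0 := by
  refine eq_zero_of_inner_le (α := (supportFun Set.univ y).toReal) fun u => ?_
  have hu : ((⟪y, u⟫ : ℝ) : EReal) ≤ supportFun Set.univ y :=
    le_iSup₂_of_le u (Set.mem_univ u) le_rfl
  exact EReal.coe_le_coe_iff.1 (hu.trans (EReal.le_coe_toReal h))

variable {X : Set (Vec m)} {f : Fin J → Vec d → Vec m → EReal}

lemma eq_neg_of_negConj_univ {j : Fin J} {x : Vec m} {a : Vec d} {b : ℝ}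
    (hf : ∀ u, f j u x = ((⟪a, u⟫ + b : ℝ) : EReal)) {z : Vec d}
    (h : negConj f Set.univ j x z ≠ ⊤) : z = -a := by
  refine eq_neg_of_add_eq_zero_left
    (eq_zero_of_inner_le (α := (negConj f Set.univ j x z).toReal - b) fun u => ?_)
  have hu : ((⟪z, u⟫ : ℝ) : EReal) + f j u x ≤ negConj f Set.univ j x z :=
    le_iSup₂_of_le u (Set.mem_univ u) le_rfl
  rw [hf, ← EReal.coe_add] at hu
  have := EReal.coe_le_coe_iff.1 (hu.trans (EReal.le_coe_toReal h))
  rw [inner_add_left]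
  linarith

/-- Only finiteness of the constraint matters: the support function of the whole space is finite
only at 0, and the conjugate of an affine piece only at minus its slope. Optimality, norm and radius
play no role. -/
lemma Feasible.z_eq_neg {N : Seminorm ℝ (Vec d)} {r : ℝ≥0∞} {ε : ℝ} {T : Fin K → Set (Vec d)}
    {n : ℕ} {D : Fin n → Vec d} {l : Fin n → Fin K} {v : Vars d m J K}
    (h : Feasible X f Set.univ Set.univ N r ε T D l v) {k : Fin K} (hk : (T k).Nonempty)
    {j : Fin J} {a : Vec d} {b : ℝ} (hf : ∀ u, f j u v.x = ((⟪a, u⟫ + b : ℝ) : EReal)) :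
    v.z j k = -a := by
  have hb : supportFun Set.univ (v.y j k) ≠ ⊥ := by
    refine ne_bot_of_le_ne_bot (EReal.coe_ne_bot ⟪v.y j k, 0⟫) ?_
    exact le_iSup₂_of_le (0 : Vec d) (Set.mem_univ _) le_rfl
  have ha : negConj f Set.univ j v.x (v.z j k - v.y j k) ≠ ⊥ := by
    refine ne_bot_of_le_ne_bot ?_
      (le_iSup₂_of_le (f := fun (u : Vec d) (_ : u ∈ Set.univ) =>
        ((⟪v.z j k - v.y j k, u⟫ : ℝ) : EReal) + f j u v.x) (0 : Vec d) (Set.mem_univ _) le_rfl)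
    rw [hf, ← EReal.coe_add]
    exact EReal.coe_ne_bot _
  obtain ⟨h1, h2⟩ := ne_top_of_add_le_coe ha hb (EReal.coe_ne_bot _)
    (transportTerm_ne_bot _ _ _ _) (h.2.2 k hk j)
  have := eq_neg_of_negConj_univ hf h1
  rwa [eq_zero_of_supportFun_univ h2, sub_zero] at this

end Dual

/-! ### Convergence of `phi` -/

section Phi

variable {d K n₀ J : ℕ}

lemma abs_ciSup_sub_ciSup_le {ι : Type*} [Finite ι] [Nonempty ι] {a b : ι → ℝ} {c : ℝ}
    (h : ∀ j, |a j - b j| ≤ c) : |(⨆ j, a j) - ⨆ j, b j| ≤ c := by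
  have key : ∀ a b : ι → ℝ, (∀ j, |a j - b j| ≤ c) → (⨆ j, a j) ≤ (⨆ j, b j) + c :=
    fun a b h => ciSup_le fun j => by
      have h1 := le_ciSup (Set.finite_range b).bddAbove j
      have h2 := abs_le.1 (h j)
      linarith [h2.2]
  rw [abs_le]
  constructor
  · linarith [key b a fun j => by rw [abs_sub_comm]; exact h j]
  · linarith [key a b h]

/-- The maximum of affine functions as a function of their coefficients. -/
def maxAffine (θ : (Fin J → Vec d) × (Fin J → ℝ)) (u : Vec d) : ℝ := ⨆ j, (⟪θ.1 j, u⟫ + θ.2 j)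

lemma abs_maxAffine_sub_le [Nonempty (Fin J)] (θ θ' : (Fin J → Vec d) × (Fin J → ℝ)) (u : Vec d) :
    |maxAffine θ u - maxAffine θ' u| ≤ ‖θ - θ'‖ * (‖u‖ + 1) := by
  refine abs_ciSup_sub_ciSup_le fun j => ?_
  have h1 : |⟪θ.1 j - θ'.1 j, u⟫| ≤ ‖θ - θ'‖ * ‖u‖ :=
    (abs_real_inner_le_norm _ _).trans (mul_le_mul_of_nonneg_right
      ((norm_le_pi_norm (θ - θ').1 j).trans (norm_fst_le _)) (norm_nonneg _))
  have h2 : |θ.2 j - θ'.2 j| ≤ ‖θ - θ'‖ :=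
    (norm_le_pi_norm (θ - θ').2 j).trans (norm_snd_le _)
  calc |⟪θ.1 j, u⟫ + θ.2 j - (⟪θ'.1 j, u⟫ + θ'.2 j)|
      = |⟪θ.1 j - θ'.1 j, u⟫ + (θ.2 j - θ'.2 j)| := by rw [inner_sub_left]; congr 1; ring
    _ ≤ _ := abs_add_le _ _
    _ ≤ _ := by rw [mul_add, mul_one]; exact add_le_add h1 h2

variable {P : Measure (Vec d)} [IsProbabilityMeasure P] {S : Set (Vec d)}
  {C : ClusteringRule d n₀ K}

lemma lipschitzFamily_maxAffine [Nonempty (Fin J)] (hP : Integrable (fun u : Vec d => u) P) :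
    LipschitzFamily P (maxAffine (d := d) (J := J)) := by
  have hm : ∀ θ, Measurable (maxAffine (d := d) (J := J) θ) := fun θ =>
    Measurable.iSup fun j => by fun_prop
  refine ⟨hm, fun θ => ?_, fun θ θ' u => ?_⟩
  · refine ((hP.norm.add (integrable_const 1)).const_mul ‖θ‖).mono' (hm θ).aestronglyMeasurable
      (Eventually.of_forall fun u => ?_)
    have h0 : maxAffine (0 : (Fin J → Vec d) × (Fin J → ℝ)) u = 0 := by simp [maxAffine]
    simpa [h0] using abs_maxAffine_sub_le θ 0 u
  · refine (abs_maxAffine_sub_le θ θ' u).trans ?_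
    rw [mul_assoc]
    refine mul_le_mul_of_nonneg_left ?_ (norm_nonneg _)
    nlinarith [norm_nonneg θ, norm_nonneg θ', norm_nonneg u,
      mul_nonneg (norm_nonneg θ) (norm_nonneg u), mul_nonneg (norm_nonneg θ') (norm_nonneg u)]

lemma ciSup_inner_neg_sub (z : Fin J → Vec d) (u m : Vec d) :
    ⨆ j, ⟪-(z j), u - m⟫ = maxAffine (fun j => -(z j), fun j => ⟪z j, m⟫) u := by
  simp only [maxAffine, inner_sub_right, inner_neg_left, sub_neg_eq_add]

lemma phi_eq_sum {n : ℕ} (hJ : 2 ≤ J) (ω : ℕ → Vec d) (l : Fin n → Fin K)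
    (z : Fin J → Fin K → Vec d) :
    phi (dataset n ω) l z = ∑ k, clusterAvg l k fun i => maxAffine (fun j => -(z j k),
      fun j => ⟪z j k, clusterMean (dataset n ω) l k⟫) (ω i) := by
  simp only [phi, if_pos hJ, clusterAvg, ← ciSup_inner_neg_sub, smul_eq_mul, ← Finset.mul_sum]
  rfl

lemma limitPhi_eq_sum (hJ : 2 ≤ J) {T : Fin K → Set (Vec d)} (hT : ∀ k, MeasurableSet (T k))
    (hP : Integrable (fun u : Vec d => u) P) (z : Fin J → Fin K → Vec d) :
    limitPhi P T z = ∑ k, ∫ u in T k, maxAffine (fun j => -(z j k),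
      fun j => ⟪z j k, limitMean P T k⟫) u ∂P := by
  have : Nonempty (Fin J) := ⟨⟨0, by omega⟩⟩
  simp only [limitPhi, if_pos hJ, ciSup_inner_neg_sub]
  rw [integral_finsetSum _ fun k _ =>
    ((lipschitzFamily_maxAffine hP).integrable _).indicator (hT k)]
  exact Finset.sum_congr rfl fun k _ => integral_indicator (hT k)

/-- On each cluster the summand is a maximum of affine functions whose coefficients converge with
the dual variables and the means. -/
lemma SupportRequirements.ae_tendsto_phi (hn₀ : 0 < n₀) (hC : SupportRequirements P S C)
    (hS : ∀ᵐ u ∂P, u ∈ S) (hP : Integrable (fun u : Vec d => u) P) :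
    ∀ᵐ ω ∂(streamLaw P), ∀ τ, DataStable C ω τ → ∀ (σ : ℕ → ℕ), Tendsto σ atTop atTop →
      ∀ (z : ℕ → Fin J → Fin K → Vec d) (zs : Fin J → Fin K → Vec d),
        (∀ j k, (C.suppAt ω τ k).Nonempty → Tendsto (fun s => z s j k) atTop (𝓝 (zs j k))) →
        Tendsto (fun s => phi (dataset (n₀ + σ s) ω) (C.labelAt ω (σ s)) (z s)) atTop
          (𝓝 (limitPhi P (C.suppAt ω τ) zs)) := by
  by_cases hJ : 2 ≤ J
  swap
  · refine Eventually.of_forall fun ω τ _ σ _ z zs _ => ?_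
    simp only [phi, limitPhi, if_neg hJ]
    exact tendsto_const_nhds
  have : Nonempty (Fin J) := ⟨⟨0, by omega⟩⟩
  filter_upwards [hC.ae_tendsto_clusterAvg hS hP (lipschitzFamily_maxAffine (J := J) hP),
    hC.ae_clusterLimits hn₀ hS hP] with ω h1 h2 τ hst σ hσ z zs hz
  have hlim := h2 τ hst
  rw [limitPhi_eq_sum hJ hlim.admissible.measurable hP]
  simp only [phi_eq_sum hJ]
  refine tendsto_finsetSum _ fun k _ => ?_
  by_cases hk : (C.suppAt ω τ k).Nonempty
  · refine h1 τ hst σ hσ k _ _ (Tendsto.prodMk_nhds (tendsto_pi_nhds.2 fun j => (hz j k hk).neg)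
      (tendsto_pi_nhds.2 fun j => (hz j k hk).inner ((hlim.mean k).comp hσ)))
  -- In an empty slot the dual variables need not converge, but no data point eventually carries its
  -- label.
  · rw [Set.not_nonempty_iff_eq_empty.1 hk, setIntegral_empty]
    refine tendsto_const_nhds.congr' ?_
    filter_upwards [hσ.eventually_ge_atTop τ] with s hs
    have := hlim.card_eq_zero _ hs k hk
    rw [clusterCard, Finset.card_eq_zero] at this
    rw [clusterAvg, this, Finset.sum_empty, smul_zero]

/-- Dual variables of norm at most `M j` give at most `max_j M_j` times the cluster value. -/
lemma limitPhi_le {T : Fin K → Set (Vec d)} (hT : ∀ k, MeasurableSet (T k))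
    (hP : MemLp (fun u : Vec d => u) 2 P) {z : Fin J → Fin K → Vec d} {M : Fin J → ℝ≥0}
    (hz : ∀ j k, (T k).Nonempty → ‖z j k‖ ≤ M j) :
    ENNReal.ofReal (limitPhi P T z) ≤ (⨆ j, (M j : ℝ≥0∞)) * limitValue 1 P T := by
  by_cases hJ : 2 ≤ J
  swap
  · simp [limitPhi, if_neg hJ]
  have : Nonempty (Fin J) := ⟨⟨0, by omega⟩⟩
  have hP1 := hP.integrable one_le_two
  have hint := (lipschitzFamily_norm_sub_rpow hP (.inl rfl)).integrable
  have hfin : (⨆ j, (M j : ℝ≥0∞)) ≠ ⊤ :=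
    (ENNReal.iSup_coe_lt_top.2 (Set.finite_range M).bddAbove).ne
  have hM : ∀ j, (M j : ℝ) ≤ (⨆ j, (M j : ℝ≥0∞)).toReal := fun j =>
    ENNReal.toReal_mono hfin (le_iSup (fun j => (M j : ℝ≥0∞)) j)
  rw [limitValue_eq zero_le_one hT hint, div_one, ENNReal.rpow_one, ← ENNReal.ofReal_toReal hfin,
    ← ENNReal.ofReal_mul ENNReal.toReal_nonneg]
  refine ENNReal.ofReal_le_ofReal ?_
  rw [limitPhi_eq_sum hJ hT hP1, Finset.mul_sum]
  refine Finset.sum_le_sum fun k _ => ?_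
  by_cases hk : (T k).Nonempty
  · rw [← integral_const_mul]
    refine integral_mono ((lipschitzFamily_maxAffine hP1).integrable _).restrict
      ((hint _).const_mul _).restrict fun u => ?_
    rw [← ciSup_inner_neg_sub]
    refine ciSup_le fun j => (real_inner_le_norm _ _).trans ?_
    rw [norm_neg, Real.rpow_one]
    exact mul_le_mul_of_nonneg_right ((hz j k hk).trans (hM j)) (norm_nonneg _)
  · simp [Set.not_nonempty_iff_eq_empty.1 hk]

end Phi

/-! ### The two parts of the theorem along a single stream -/

section Stream

variable {d m J K : ℕ}

/-- Between the points 0 and `a` the piece changes by `‖a‖ ^ 2`. -/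
lemma LipschitzPieces.norm_le {X : Set (Vec m)} {f : Fin J → Vec d → Vec m → EReal}
    {M : Fin J → ℝ≥0} (h : LipschitzPieces X f Set.univ M) {j : Fin J} {x : Vec m} (hx : x ∈ X)
    {a : Vec d} {b : ℝ} (hf : ∀ u, f j u x = ((⟪a, u⟫ + b : ℝ) : EReal)) : ‖a‖ ≤ M j := by
  have h1 := (h j x hx).2 0 (Set.mem_univ _) a (Set.mem_univ _)
  simp only [hf, EReal.toReal_coe, inner_zero_right, zero_add, add_sub_cancel_right, zero_sub,
    norm_neg, real_inner_self_eq_norm_sq] at h1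
  rw [abs_of_nonneg (by positivity), sq] at h1
  by_contra hc
  have : 0 < ‖a‖ := lt_of_le_of_lt (M j).2 (not_le.1 hc)
  exact hc (le_of_mul_le_mul_right h1 this)

/-- An accumulation point that achieves the limit superior exists for dual variables that depend
continuously on points of a compact set. -/
lemma exists_achievesLimsup {X : Set (Vec m)} (hX : IsCompact X) {A : Fin J → Vec m → Vec d}
    (hA : ∀ j, Continuous (A j)) {T : Fin K → Set (Vec d)} {τ : ℕ} {x : ℕ → Vec m}
    (hx : ∀ t, x t ∈ X) {z : ℕ → Fin J → Fin K → Vec d}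
    (hz : ∀ t ≥ τ, ∀ j k, (T k).Nonempty → z t j k = -A j (x t)) (Φ : ℕ → ℝ) :
    ∃ zs, AchievesLimsup T Φ z zs := by
  -- In `EReal` the limit superior is always a cluster point; compactness of `X` then thins the
  -- subsequence so that `x` converges too.
  obtain ⟨σ, hσ, hlim⟩ := (MapClusterPt.limsup (f := atTop)
    (u := fun t => ((Φ t : ℝ) : EReal))).tendsto_subseq
  obtain ⟨xs, -, ψ, hψ, hxs⟩ := hX.tendsto_subseq fun s => hx (σ s)
  refine ⟨fun j _ => -A j xs, σ ∘ ψ, hσ.comp hψ, fun j k hk => ?_, hlim.comp hψ.tendsto_atTop⟩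
  refine ((((hA j).tendsto xs).comp hxs).neg).congr' ?_
  filter_upwards [(hσ.comp hψ).tendsto_atTop.eventually_ge_atTop τ] with s hs
  exact (hz _ hs j k hk).symm

end Stream

end ClusterDRO

end

open ClusterDRO in
theorem mainTheorem11 {d m J K n₀ : ℕ} (hJ : 0 < J) (hn₀ : 0 < n₀)
    (P : Measure (Vec d)) [IsProbabilityMeasure P] (hP : MemLp (fun u : Vec d => u) 2 P)
    (S : Set (Vec d)) (hS : ∀ᵐ u ∂P, u ∈ S)
    (X : Set (Vec m)) (f : Fin J → Vec d → Vec m → EReal) (dom : Set (Vec d))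
    (hf : ObjectiveSetting X f dom S) (hdom : DomainCondition X f dom)
    (M L : Fin J → ℝ≥0) (L₀ : ℝ≥0)
    (hreg : LipschitzPieces X f dom M ∨ SmoothPieces X f dom L ∨ SmoothMax X f dom L₀)
    (C : ClusteringRule d n₀ K) (hC : SupportRequirements P S C) :
    -- clustering that is optimal for `p = 2`
    ((∀ᵐ ω ∂(streamLaw P), ∀ t,
        clusterValue 2 (dataset (n₀ + t) ω) (C.labelAt ω t)
            = clusterWass 2 (dataset (n₀ + t) ω) (C.labelAt ω t) ∧
          clusterWass 2 (dataset (n₀ + t) ω) (C.labelAt ω t)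
            = quantError K 2 (empirical (dataset (n₀ + t) ω))) →
      ∀ᵐ ω ∂(streamLaw P), ∀ τ, (∀ t ≥ τ, C.suppAt ω t = C.suppAt ω τ) →
        psiUpper X f dom M L P (C.suppAt ω τ)
          = min (smoothTerm X f dom L (quantError K 2 P)) (lipTerm X f dom M P (C.suppAt ω τ))) ∧
    -- maximum-of-affine objective, full support, clustering-induced coupling optimal for `p = 1`
    (∀ (N : Seminorm ℝ (Vec d)) (r : ℝ≥0∞) (ε : ℕ → ℝ) (sol : ℕ → (ℕ → Vec d) → Vars d m J K),
      (∀ v, N v = 0 → v = 0) → 1 ≤ r → (∀ t, 0 ≤ ε t) →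
      (∀ᵐ ω ∂(streamLaw P), ∀ t, IsOptimal X f dom S N r (ε t) (C.suppAt ω t)
        (dataset (n₀ + t) ω) (C.labelAt ω t) (sol t ω)) →
      MaxOfAffine X f → S = Set.univ →
      (∀ᵐ ω ∂(streamLaw P), ∀ t,
        clusterValue 1 (dataset (n₀ + t) ω) (C.labelAt ω t)
          = clusterWass 1 (dataset (n₀ + t) ω) (C.labelAt ω t)) →
      ∀ᵐ ω ∂(streamLaw P), ∀ τ, (∀ t ≥ τ, C.suppAt ω t = C.suppAt ω τ) →
        let T := C.suppAt ω τ
        let Φ : ℕ → ℝ := fun t => phi (dataset (n₀ + t) ω) (C.labelAt ω t) (sol t ω).z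
        (∃ zs, AchievesLimsup T Φ (fun t => (sol t ω).z) zs) ∧
        ∀ zs, AchievesLimsup T Φ (fun t => (sol t ω).z) zs →
          psiLower X f dom M L₀ P T Φ (fun t => (sol t ω).x) ≤ ((limitPhi P T zs : ℝ) : EReal) ∧
          ((limitPhi P T zs : ℝ) : EReal) ≤ ((lipTerm X f dom M P T : ℝ≥0∞) : EReal)) := by
  have hP1 : Integrable (fun u : Vec d => u) P := hP.integrable one_le_two
  refine ⟨fun hopt => ?_, fun N r ε sol _ _ _ hsol haff hSu hopt => ?_⟩
  · filter_upwards [ae_limitValue_eq_quantError hn₀ hC hS hP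
      (hopt.mono fun ω h t => (h t).1.trans (h t).2)] with ω h τ hst
    have hds : DataStable C ω τ := fun t ht k i _ => by rw [hst t ht]
    rw [psiUpper, h τ hds]
  · have hdu : dom = Set.univ := Set.univ_subset_iff.1 (hSu ▸ hf.supp_subset)
    choose A b hAb using haff
    filter_upwards [hsol, ae_limitValue_le_limitWass hn₀ hC hS hP hopt,
      hC.ae_tendsto_phi (J := J) hn₀ hS hP1, hC.ae_admissible hS] with ω hs hW hphi hadm τ hst
    have hds : DataStable C ω τ := fun t ht k i _ => by rw [hst t ht]
    have hx : ∀ t, (sol t ω).x ∈ X := fun t => (hs t).1.1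
    have hz : ∀ t ≥ τ, ∀ j k, (C.suppAt ω τ k).Nonempty →
        (sol t ω).z j k = -A j (sol t ω).x := fun t ht j k hk => by
      have hfeas := (hs t).1
      rw [hdu, hSu] at hfeas
      exact hfeas.z_eq_neg (by rwa [hst t ht]) (hAb j _ (hx t))
    refine ⟨exists_achievesLimsup hf.compact (fun j => (A j).continuous_of_finiteDimensional) hx hz
      _, fun zs hzs => ?_⟩
    obtain ⟨σ, hσ, hzlim, hΦlim⟩ := hzs
    constructor
    · refine (min_le_left _ _).trans_eq (tendsto_nhds_unique hΦlim ?_)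
      exact (continuous_coe_real_ereal.tendsto _).comp
        (hphi τ hds σ hσ.tendsto_atTop (fun s => (sol (σ s) ω).z) zs hzlim)
    · have hle : ∀ r : ℝ, (r : EReal) ≤ ((ENNReal.ofReal r : ℝ≥0∞) : EReal) := fun r => by
        rw [EReal.coe_ennreal_ofReal]
        exact EReal.coe_le_coe_iff.2 (le_max_left _ _)
      refine (hle _).trans (EReal.coe_ennreal_le_coe_ennreal_iff.2 ?_)
      rw [lipTerm]
      split_ifs with hlip
      · refine (limitPhi_le (M := M) (hadm τ).measurable hP fun j k hk => ?_).trans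
          (mul_le_mul_right (hW τ hds) _)
        -- The bound by `M j` holds for every slope along the sequence and passes to the limit.
        refine le_of_tendsto (hzlim j k hk).norm ?_
        filter_upwards [hσ.tendsto_atTop.eventually_ge_atTop τ] with s hs'
        rw [hz _ hs' j k hk, norm_neg]
        rw [hdu] at hlip
        exact hlip.norm_le (hx _) (hAb j _ (hx _))
      · exact le_top
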